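/- Let $I=[0,1]$ with Lebesgue measure $m$, let $1\le p<\infty$, and fix a constant $A>0$. For $f:I\to\mathbb C$, $r>0$ and $x\in I$ put $$\operatorname{osc}(f,r,x)=\sup\{|f(y_1)-f(y_2)| : y_1,y_2\in(x-r,x+r)\cap I\},\qquad \operatorname{var}_{1,1/p}(f)=\sup_{0<r\le A} r^{-1/p}\int_I\operatorname{osc}(f,r,x)\,dm(x).$$ For the class of $f$ modulo $m$-null sets, $\operatorname{var}_{1,1/p}$ is the infimum of this quantity over all versions of $f$; $BV_{1,1/p}$ is the space of classes of integrable functions with $\operatorname{var}_{1,1/p}(f)<\infty$, and $\|f\|_{1,1/p}=\operatorname{var}_{1,1/p}(f)+\|f\|_1$. Let $\tau:I\to I$ be a piecewise expanding $C^{1+1/p}$ map: there are $0=a_0<a_1<\dots<a_q=1$ such that, for each $i$, on $I_i=(a_{i-1},a_i)$ the map $\tau$ is monotonic, extends to a $C^1$ function on $\overline{I_i}$, has a $1/p$-Hölder continuous derivative, and satisfies $|\tau'|\ge s_i>1$. Let $s=\min_i s_i$ and assume $$\frac1{s^{1/p}}+\frac1s<1 .$$ Let $P_\tau$ be the Frobenius–Perron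 operator, $P_\tau f(x)=\sum_{i=1}^q \frac{f(\tau_i^{-1}x)}{|\tau'(\tau_i^{-1}x)|}\chi_{\tau(I_i)}(x)$ with $\tau_i=\tau|_{I_i}$. Then for every sufficiently small $A>0$ (depending on $\tau$ and $p$) there are constants $0<\alpha<1$ and $K>0$ such that: 1. $\|P_\tau f\|_{1,1/p}\le\alpha\|f\|_{1,1/p}+K\|f\|_1$ for all $f\in BV_{1,1/p}$; 2. the iterates of $P_\tau$ are uniformly bounded on $BV_{1,1/p}$: for all $f\in BV_{1,1/p}$ and all $n\ge 0$, $P_\tau^nf\in BV_{1,1/p}$ and $\|P_\tau^nf\|_{1,1/p}\le\left(1+\frac K{1-\alpha}\right)\|f\|_{1,1/p}$; 3. for every $f\in BV_{1,1/p}$ and all sufficiently large $n$ (depending on $f$), $$\|P_\tau^n f\|_{1,1/p}\le\Bigl(1+\frac{K}{1-\alpha}\Bigr)\|f\|_1 .$$ -/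

import Mathlib

open MeasureTheory Set Filter

noncomputable section

namespace GenBV

/-- Lebesgue measure on the unit interval `I = [0, 1]`. Functions on `I` are represented by
functions on `ℝ`, of which only the values on `I` are ever used. -/
def mI : Measure ℝ := volume.restrict (Icc (0 : ℝ) 1)

/-- `S_r(x) = (x - r, x + r) ∩ I`. -/
def nbhd (r x : ℝ) : Set ℝ := Ioo (x - r) (x + r) ∩ Icc 0 1

/-- The oscillation `osc(f, r, x) = sup_{y₁, y₂ ∈ S_r(x)} |f(y₁) - f(y₂)|`, with value in `[0, ∞]`. -/
def osc (f : ℝ → ℂ) (r x : ℝ) : ENNReal :=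
  ⨆ y₁ ∈ nbhd r x, ⨆ y₂ ∈ nbhd r x, ‖f y₁ - f y₂‖ₑ

/-- `osc₁(f, r)`, the `L¹`-norm over `I` of `osc(f, r, ·)`. -/
def oscOne (f : ℝ → ℂ) (r : ℝ) : ENNReal := ∫⁻ x, osc f r x ∂mI

/-- `var_{1,1/p}(f) = sup_{0 < r ≤ A} osc₁(f, r) / r^{1/p}` of a function. -/
def varFun (A p : ℝ) (f : ℝ → ℂ) : ENNReal :=
  ⨆ r ∈ Ioc (0 : ℝ) A, oscOne f r / ENNReal.ofReal (r ^ (1 / p))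

/-- `var_{1,1/p}` of the equivalence class of `f` modulo Lebesgue null sets:
the infimum of the variations of the versions of `f`. -/
def var (A p : ℝ) (f : ℝ → ℂ) : ENNReal :=
  ⨅ (g : ℝ → ℂ) (_ : g =ᵐ[mI] f), varFun A p g

/-- The `L¹`-norm over `I`. -/
def normOne (f : ℝ → ℂ) : ENNReal := ∫⁻ x, ‖f x‖ₑ ∂mI

/-- The norm `‖f‖_{1,1/p} = var_{1,1/p}(f) + ‖f‖₁` (of the class of `f`). -/
def normBV (A p : ℝ) (f : ℝ → ℂ) : ENNReal := var A p f + normOne f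

/-- The class of `f` belongs to `BV_{1,1/p}`. -/
def MemBV (A p : ℝ) (f : ℝ → ℂ) : Prop := Integrable f mI ∧ var A p f < ⊤

/-- The `i`-th open interval `(a_{i-1}, a_i)` of the partition with the endpoints `a`. -/
def piece {q : ℕ} (a : Fin (q + 1) → ℝ) (i : Fin q) : Set ℝ := Ioo (a i.castSucc) (a i.succ)

/-- `τ` is a piecewise expanding `C^{1+ε}` map of `I`, with respect to the partition
`0 = a₀ < a₁ < ⋯ < a_q = 1` and with the lower bounds `s i` of the slopes. -/
structure IsPiecewiseExpanding (ε : ℝ) {q : ℕ} (a : Fin (q + 1) → ℝ) (s : Fin q → ℝ)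
    (τ : ℝ → ℝ) : Prop where
  strictMono : StrictMono a
  first : a 0 = 0
  last : a (Fin.last q) = 1
  mapsTo : MapsTo τ (Icc 0 1) (Icc 0 1)
  monotonic : ∀ i, MonotoneOn τ (piece a i) ∨ AntitoneOn τ (piece a i)
  extends_C1 : ∀ i, ∃ τi : ℝ → ℝ,
    ContDiffOn ℝ 1 τi (Icc (a i.castSucc) (a i.succ)) ∧ EqOn τi τ (piece a i)
  holder : ∀ i, ∃ M : ℝ, ∀ x ∈ piece a i, ∀ y ∈ piece a i,
    |deriv τ x - deriv τ y| ≤ M * |x - y| ^ ε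
  one_lt : ∀ i, 1 < s i
  expanding : ∀ i, ∀ x ∈ piece a i, s i ≤ |deriv τ x|

/-- The Frobenius-Perron operator
`P_τ f (x) = ∑ᵢ f(τᵢ⁻¹ x) / |τ'(τᵢ⁻¹ x)| · χ_{τ(Iᵢ)}(x)`,
where `τᵢ⁻¹` is the inverse of the restriction of `τ` to the `i`-th interval of the partition. -/
def frobeniusPerron {q : ℕ} (a : Fin (q + 1) → ℝ) (τ : ℝ → ℝ) (f : ℝ → ℂ) : ℝ → ℂ :=
  fun x => ∑ i : Fin q, (τ '' piece a i).indicator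
    (fun x => f (Function.invFunOn τ (piece a i) x) /
      (|deriv τ (Function.invFunOn τ (piece a i) x)| : ℝ)) x

end GenBV

end

/-!
Let `1 < σ ≤ inf s`. Each branch of `τ` extends to a homeomorphism `T` of the line which expands
distances by `σ`. The change of variables `x = T z` turns the oscillation at scale `r` of the
contribution of the branch to `P_τ f` into the oscillation at scale `r / σ` of `f`, cut off to the
piece and divided by `|T'|`; the Hölder condition on `τ'` bounds the effect of this weight by a
distortion `1 + O(r ^ (1 / p))`, which tends to `1` as `A` tends to `0`.

Cutting `f` off creates jumps at the endpoints of the piece. Near an endpoint they are bounded by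
values of `f` within the piece, and sampling these values at the larger scale `A` spreads them over
an interval of length `A`: the price is `r / (σ * A)` times the oscillation at the scale `A` plus an
`L¹`-norm. After division by `r ^ (1 / p)` the interior oscillation contributes `1 / σ ^ (1 / p)`
and the endpoints `1 / σ`. When `p = 1` the factor of the `L¹`-norm must itself be `O(r)`, which an
average over many translates achieves.

The resulting inequality `var (P_τ f) ≤ α * var f + K * ‖f‖₁` is of Lasota-Yorke type. As `P_τ` does
not increase the `L¹`-norm, iterating gives
`‖P_τ ^ n f‖ ≤ α ^ n * ‖f‖ + K / (1 - α) * ‖f‖₁`, hence the bounds for all `n` and for large `n`.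
-/

noncomputable section

namespace GenBV

section Oscillation

variable {X E : Type*} [PseudoMetricSpace X]

/-- The oscillation of `f` over the ball of radius `r` about `x`, taken relative to the set `s`.
With `s = [0, 1]` it is `osc`; the cases of an interval and of the whole space allow the pieces of
a partition to be treated separately. -/
def oscOn [PseudoEMetricSpace E] (s : Set X) (f : X → E) (r : ℝ) (x : X) : ENNReal :=
  Metric.ediam (f '' (Metric.ball x r ∩ s))

section EMetric

variable [PseudoEMetricSpace E] {s t : Set X} {f : X → E} {r R : ℝ} {x : X}

lemma oscOn_le_iff {c : ENNReal} :
    oscOn s f r x ≤ c ↔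
      ∀ y₁ ∈ Metric.ball x r ∩ s, ∀ y₂ ∈ Metric.ball x r ∩ s, edist (f y₁) (f y₂) ≤ c :=
  Metric.ediam_image_le_iff

lemma edist_le_oscOn {y₁ y₂ : X} (h₁ : y₁ ∈ Metric.ball x r ∩ s)
    (h₂ : y₂ ∈ Metric.ball x r ∩ s) : edist (f y₁) (f y₂) ≤ oscOn s f r x :=
  oscOn_le_iff.1 le_rfl y₁ h₁ y₂ h₂

lemma oscOn_mono (hst : s ⊆ t) (hrR : r ≤ R) : oscOn s f r x ≤ oscOn t f R x :=
  Metric.ediam_mono <| image_mono <| inter_subset_inter (Metric.ball_subset_ball hrR) hst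

lemma oscOn_le_oscOn_comp {Y : Type*} [PseudoMetricSpace Y] {e : Y → X} {t : Set Y} {y : Y}
    (h : Metric.ball x r ∩ s ⊆ e '' (Metric.ball y R ∩ t)) :
    oscOn s f r x ≤ oscOn t (f ∘ e) R y := by
  rw [oscOn, oscOn, image_comp]
  exact Metric.ediam_mono (image_mono h)

lemma oscOn_comp_isometryEquiv {Y : Type*} [PseudoMetricSpace Y] (e : Y ≃ᵢ X) (y : Y) :
    oscOn (e ⁻¹' s) (f ∘ e) r y = oscOn s f r (e y) := by
  rw [oscOn, oscOn, image_comp, image_inter_preimage, e.image_ball]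

lemma lowerSemicontinuous_oscOn : LowerSemicontinuous (oscOn s f r) := by
  refine fun x c hc => ?_
  obtain ⟨y₁, h₁, y₂, h₂, h⟩ : ∃ y₁ ∈ Metric.ball x r ∩ s, ∃ y₂ ∈ Metric.ball x r ∩ s,
      c < edist (f y₁) (f y₂) := by
    by_contra! H
    exact hc.not_ge (oscOn_le_iff.2 H)
  have near : ∀ y ∈ Metric.ball x r, ∀ᶠ x' in nhds x, y ∈ Metric.ball x' r := fun y hy => by
    simp only [Metric.mem_ball_comm (x := y)]
    exact Metric.isOpen_ball.mem_nhds (Metric.mem_ball_comm.1 hy)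
  filter_upwards [near y₁ h₁.1, near y₂ h₂.1] with x' hx₁ hx₂
  exact h.trans_le (edist_le_oscOn ⟨hx₁, h₁.2⟩ ⟨hx₂, h₂.2⟩)

lemma measurable_oscOn [MeasurableSpace X] [OpensMeasurableSpace X] :
    Measurable (oscOn s f r) :=
  lowerSemicontinuous_oscOn.measurable

end EMetric

section Normed

variable [NormedAddCommGroup E] {s : Set X} {f : X → E} {r R ρ : ℝ} {x z : X}

lemma enorm_le_oscOn_add {y₁ y₂ : X} (h₁ : y₁ ∈ Metric.ball x r ∩ s)
    (h₂ : y₂ ∈ Metric.ball x r ∩ s) : ‖f y₁‖ₑ ≤ oscOn s f r x + ‖f y₂‖ₑ := by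
  rw [← edist_zero_right, ← edist_zero_right]
  exact (edist_triangle _ (f y₂) _).trans (by gcongr; exact edist_le_oscOn h₁ h₂)

lemma oscOn_sum_le {ι : Type*} (t : Finset ι) (g : ι → X → E) :
    oscOn s (fun y => ∑ i ∈ t, g i y) r x ≤ ∑ i ∈ t, oscOn s (g i) r x := by
  refine oscOn_le_iff.2 fun y₁ h₁ y₂ h₂ => ?_
  rw [edist_eq_enorm_sub, ← Finset.sum_sub_distrib]
  refine (enorm_sum_le _ _).trans (Finset.sum_le_sum fun i _ => ?_)
  rw [← edist_eq_enorm_sub]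
  exact edist_le_oscOn h₁ h₂

lemma oscOn_indicator_le_of_ball_subset (h : Metric.ball z ρ ⊆ s) :
    oscOn univ (s.indicator f) ρ z ≤ oscOn s f ρ z := by
  rw [oscOn, oscOn, inter_univ, inter_eq_left.2 h,
    image_congr fun y hy => indicator_of_mem (h hy) f]

lemma oscOn_indicator_eq_zero (h : Disjoint (Metric.ball z ρ) s) :
    oscOn univ (s.indicator f) ρ z = 0 := by
  refine nonpos_iff_eq_zero.1 (oscOn_le_iff.2 fun y₁ h₁ y₂ h₂ => ?_)
  rw [indicator_of_notMem (h.notMem_of_mem_left h₁.1),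
    indicator_of_notMem (h.notMem_of_mem_left h₂.1), edist_self]

lemma oscOn_indicator_le {w : X} (hw : w ∈ Metric.ball x R ∩ s)
    (h : Metric.ball z ρ ∩ s ⊆ Metric.ball x R) :
    oscOn univ (s.indicator f) ρ z ≤ oscOn s f R x + ‖f w‖ₑ := by
  have image_subset : s.indicator f '' (Metric.ball z ρ ∩ univ) ⊆
      insert 0 (f '' (Metric.ball x R ∩ s)) := by
    rintro _ ⟨y, hy, rfl⟩
    by_cases hys : y ∈ s
    · rw [indicator_of_mem hys]
      exact .inr ⟨y, ⟨h ⟨hy.1, hys⟩, hys⟩, rfl⟩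
    · exact .inl (indicator_of_notMem hys f)
  refine (Metric.ediam_mono image_subset).trans ?_
  rw [Metric.ediam_insert]
  refine max_le (iSup₂_le ?_) le_self_add
  rintro _ ⟨y, hy, rfl⟩
  rw [edist_zero_left]
  exact enorm_le_oscOn_add hy hw

variable [NormedSpace ℝ E] {w : X → ℝ}

open scoped Pointwise in
lemma oscOn_smul_le_of_le {k : ℝ} (hw₀ : ∀ y, 0 ≤ w y) (hwk : ∀ y, w y ≤ k)
    (hf : ∃ y ∈ Metric.ball x r, f y = 0) :
    oscOn univ (fun y => w y • f y) r x ≤ ENNReal.ofReal k * oscOn univ f r x := by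
  obtain ⟨y₀, hy₀, hfy₀⟩ := hf
  have hk : 0 ≤ k := (hw₀ x).trans (hwk x)
  set B := f '' (Metric.ball x r ∩ univ)
  have image_subset : (fun y => w y • f y) '' (Metric.ball x r ∩ univ) ⊆ k • convexHull ℝ B := by
    rintro _ ⟨y, hy, rfl⟩
    rcases hk.eq_or_lt with rfl | hk
    · refine ⟨f y, subset_convexHull ℝ B ⟨y, hy, rfl⟩, ?_⟩
      simp [le_antisymm (hwk y) (hw₀ y)]
    refine ⟨(w y / k) • f y, ?_, by simp only [smul_smul, mul_div_cancel₀ _ hk.ne']⟩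
    exact (convex_convexHull ℝ B).smul_mem_of_zero_mem
      (subset_convexHull ℝ B ⟨y₀, ⟨hy₀, mem_univ _⟩, hfy₀⟩) (subset_convexHull ℝ B ⟨y, hy, rfl⟩)
      ⟨div_nonneg (hw₀ y) hk.le, div_le_one_of_le₀ (hwk y) hk.le⟩
  calc oscOn univ (fun y => w y • f y) r x ≤ Metric.ediam (k • convexHull ℝ B) :=
        Metric.ediam_mono image_subset
    _ = ENNReal.ofReal k * oscOn univ f r x := by
        rw [ediam_smul₀, convexHull_ediam, Real.nnnorm_of_nonneg hk, ENNReal.smul_def, smul_eq_mul,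
          ENNReal.ofReal_eq_coe_nnreal hk]
        rfl

lemma oscOn_smul_le_of_abs_sub_le {c : ℝ} (hr : 0 < r) (hwx : 0 ≤ w x) (hc : 0 ≤ c)
    (hw : ∀ y ∈ Metric.ball x r, f y ≠ 0 → |w y - w x| ≤ c * w x) :
    oscOn univ (fun y => w y • f y) r x ≤ ENNReal.ofReal (w x) *
      ((1 + ENNReal.ofReal (2 * c)) * oscOn univ f r x + ENNReal.ofReal (2 * c) * ‖f x‖ₑ) := by
  have hx : x ∈ Metric.ball x r ∩ univ := ⟨Metric.mem_ball_self hr, mem_univ _⟩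
  have weight_sub : ∀ y ∈ Metric.ball x r ∩ univ, ‖(w y - w x) • f y‖ₑ ≤
      ENNReal.ofReal (c * w x) * (oscOn univ f r x + ‖f x‖ₑ) := by
    intro y hy
    by_cases hfy : f y = 0
    · simp [hfy]
    rw [enorm_smul, Real.enorm_eq_ofReal_abs]
    gcongr
    · exact hw y hy.1 hfy
    · exact enorm_le_oscOn_add hy hx
  refine oscOn_le_iff.2 fun y₁ h₁ y₂ h₂ => ?_
  have split : w y₁ • f y₁ - w y₂ • f y₂ =
      w x • (f y₁ - f y₂) + (w y₁ - w x) • f y₁ - (w y₂ - w x) • f y₂ := by module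
  rw [edist_eq_enorm_sub, split]
  calc _ ≤ ‖w x • (f y₁ - f y₂)‖ₑ + ‖(w y₁ - w x) • f y₁‖ₑ + ‖(w y₂ - w x) • f y₂‖ₑ :=
        enorm_sub_le.trans (by gcongr; exact enorm_add_le _ _)
    _ ≤ ENNReal.ofReal (w x) * oscOn univ f r x +
          ENNReal.ofReal (c * w x) * (oscOn univ f r x + ‖f x‖ₑ) +
          ENNReal.ofReal (c * w x) * (oscOn univ f r x + ‖f x‖ₑ) := by
        gcongr
        · rw [enorm_smul, Real.enorm_of_nonneg hwx, ← edist_eq_enorm_sub]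
          gcongr
          exact edist_le_oscOn h₁ h₂
        · exact weight_sub y₁ h₁
        · exact weight_sub y₂ h₂
    _ = _ := by
        rw [ENNReal.ofReal_mul hc, ENNReal.ofReal_mul zero_le_two, ENNReal.ofReal_ofNat]
        ring

end Normed

lemma osc_eq_oscOn (f : ℝ → ℂ) : osc f = oscOn (Icc 0 1) f := by
  ext r x
  simp only [osc, oscOn, nbhd, Metric.ediam, iSup_image, Real.ball_eq_Ioo, edist_eq_enorm_sub]

end Oscillation

section ExpandingExtension

variable {σ u v : ℝ} {τ : ℝ → ℝ}

/-- `T` is a homeomorphism of the line which extends the branch of `τ` on `(u, v)` and expands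
distances by `σ`. Outside `[u, v]` its slope is the least possible one, so that `|T'|⁻¹` has its
greatest value there. -/
structure IsExpandingExtension (σ u v : ℝ) (τ : ℝ → ℝ) (T : ℝ ≃ₜ ℝ) : Prop where
  eqOn : EqOn T τ (Ioo u v)
  mul_dist_le : ∀ x y, σ * dist x y ≤ dist (T x) (T y)
  differentiableAt : ∀ x ∉ ({u, v} : Set ℝ), DifferentiableAt ℝ T x
  abs_deriv_eq : ∀ x ∉ Icc u v, |deriv T x| = σ

lemma exists_homeomorph_eq_mul_add {g : ℝ → ℝ} (hσ : 0 < σ) (hg : Continuous g)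
    (hmono : Monotone g) : ∃ T : ℝ ≃ₜ ℝ, ∀ x, T x = σ * x + g x := by
  have strictMono : StrictMono fun x => σ * x + g x :=
    (strictMono_mul_left_of_pos hσ).add_monotone hmono
  have top : Tendsto (fun x => σ * x + g x) atTop atTop := by
    refine tendsto_atTop_add_right_of_le' _ (g 0) (tendsto_id.const_mul_atTop hσ) ?_
    filter_upwards [eventually_ge_atTop 0] with x hx using hmono hx
  have bot : Tendsto (fun x => σ * x + g x) atBot atBot := by
    refine tendsto_atBot_add_right_of_ge' _ (g 0) (tendsto_id.const_mul_atBot hσ) ?_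
    filter_upwards [eventually_le_atBot 0] with x hx using hmono hx
  have surjective := Continuous.surjective (by fun_prop) top bot
  exact ⟨(strictMono.orderIsoOfSurjective _ surjective).toHomeomorph, fun _ => rfl⟩

lemma mul_dist_le_dist_mul_add {g : ℝ → ℝ} (hmono : Monotone g) (x y : ℝ) :
    σ * dist x y ≤ dist (σ * x + g x) (σ * y + g y) := by
  wlog hxy : y ≤ x generalizing x y
  · simpa only [dist_comm] using this y x (le_of_not_ge hxy)
  have := hmono hxy
  rw [Real.dist_eq, Real.dist_eq, abs_of_nonneg (sub_nonneg.2 hxy)]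
  exact le_trans (by linarith) (le_abs_self _)

lemma hasDerivAt_mul_add_IccExtend (h : u ≤ v) (f : Icc u v → ℝ) {x : ℝ} (hx : x ∉ Icc u v) :
    HasDerivAt (fun y => σ * y + IccExtend h f y) σ x := by
  have const : ∃ c, IccExtend h f =ᶠ[nhds x] fun _ => c := by
    rcases lt_or_ge x u with hxu | hux
    · exact ⟨_, mem_of_superset (Iio_mem_nhds hxu) fun y hy =>
        IccExtend_of_le_left h f (mem_Iio.1 hy).le⟩
    · exact ⟨_, mem_of_superset (Ioi_mem_nhds (not_le.1 fun hxv => hx ⟨hux, hxv⟩)) fun y hy =>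
        IccExtend_of_right_le h f (mem_Ioi.1 hy).le⟩
  obtain ⟨c, hc⟩ := const
  have affine : HasDerivAt (fun y => σ * y + c) σ x := by
    simpa using ((hasDerivAt_id x).const_mul σ).add_const c
  exact affine.congr_of_eventuallyEq (hc.mono fun y hy => by simp only [hy])

lemma IsExpandingExtension.neg {T : ℝ ≃ₜ ℝ} (h : IsExpandingExtension σ u v (-τ) T) :
    IsExpandingExtension σ u v τ (T.trans (Homeomorph.neg ℝ)) := by
  have coe : ⇑(T.trans (Homeomorph.neg ℝ)) = -T := rfl
  have abs_deriv (x : ℝ) : |deriv (-T : ℝ → ℝ) x| = |deriv T x| := by rw [deriv.neg, abs_neg]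
  refine ⟨fun x hx => ?_, fun x y => ?_, fun x hx => ?_, fun x hx => ?_⟩
  · simp [h.eqOn hx]
  · simpa [coe] using h.mul_dist_le x y
  · exact (h.differentiableAt x hx).neg
  · rw [coe, abs_deriv]
    exact h.abs_deriv_eq x hx

lemma monotoneOn_sub_mul_of_le_deriv {τ₀ : ℝ → ℝ} (hτ₀ : ContinuousOn τ₀ (Icc u v))
    (hd : ∀ x ∈ Ioo u v, DifferentiableAt ℝ τ₀ x ∧ σ ≤ deriv τ₀ x) :
    MonotoneOn (fun x => τ₀ x - σ * x) (Icc u v) := by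
  have hasDerivAt : ∀ x ∈ Ioo u v, HasDerivAt (fun x => τ₀ x - σ * x) (deriv τ₀ x - σ) x :=
    fun x hx => by simpa using (hd x hx).1.hasDerivAt.fun_sub ((hasDerivAt_id x).const_mul σ)
  refine monotoneOn_of_deriv_nonneg (convex_Icc u v) (by fun_prop) (fun x hx => ?_) fun x hx => ?_
  · rw [interior_Icc] at hx
    exact (hasDerivAt x hx).differentiableAt.differentiableWithinAt
  · rw [interior_Icc] at hx
    rw [(hasDerivAt x hx).deriv]
    exact sub_nonneg.2 (hd x hx).2

-- The extension is `σ x + g x`, where `g` extends the monotone function `τ x - σ x` on `[u, v]`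
-- by constants.
lemma exists_isExpandingExtension_of_le_deriv {τ₀ : ℝ → ℝ} (huv : u < v) (hσ : 0 < σ)
    (hτ₀ : ContinuousOn τ₀ (Icc u v)) (heq : EqOn τ₀ τ (Ioo u v))
    (hd : ∀ x ∈ Ioo u v, σ ≤ deriv τ x) : ∃ T, IsExpandingExtension σ u v τ T := by
  have hasDerivAt : ∀ x ∈ Ioo u v, HasDerivAt τ₀ (deriv τ x) x := fun x hx =>
    (differentiableAt_of_deriv_ne_zero (hσ.trans_le (hd x hx)).ne').hasDerivAt.congr_of_eventuallyEq
      (heq.eventuallyEq_of_mem (Ioo_mem_nhds hx.1 hx.2))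
  have monotoneOn := monotoneOn_sub_mul_of_le_deriv hτ₀ fun x hx =>
    ⟨(hasDerivAt x hx).differentiableAt, (hasDerivAt x hx).deriv ▸ hd x hx⟩
  set g := IccExtend huv.le fun x : Icc u v => τ₀ x - σ * x
  have g_monotone : Monotone g := (monotoneOn_iff_monotone.1 monotoneOn).IccExtend huv.le
  have continuousOn : ContinuousOn (fun x => τ₀ x - σ * x) (Icc u v) := by fun_prop
  have g_continuous : Continuous g :=
    (continuousOn_iff_continuous_domRestrict.1 continuousOn).Icc_extend'
  obtain ⟨T, hT⟩ := exists_homeomorph_eq_mul_add hσ g_continuous g_monotone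
  have T_eq_inside : EqOn T τ₀ (Ioo u v) := fun x hx => by
    simp [hT, g, IccExtend_of_mem huv.le _ (Ioo_subset_Icc_self hx)]
  have hasDerivAt_inside : ∀ x ∈ Ioo u v, HasDerivAt T (deriv τ x) x := fun x hx =>
    (hasDerivAt x hx).congr_of_eventuallyEq
      (T_eq_inside.eventuallyEq_of_mem (Ioo_mem_nhds hx.1 hx.2))
  have hasDerivAt_outside : ∀ x ∉ Icc u v, HasDerivAt T σ x := fun x hx => by
    rw [funext hT]
    exact hasDerivAt_mul_add_IccExtend huv.le _ hx
  refine ⟨T, T_eq_inside.trans heq, fun x y => ?_, fun x hx => ?_, fun x hx => ?_⟩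
  · simpa only [hT] using mul_dist_le_dist_mul_add g_monotone x y
  · have inside_or_outside : x ∈ Ioo u v ∨ x ∉ Icc u v := by
      rw [← Icc_sdiff_both]
      tauto
    exact inside_or_outside.elim (fun h => (hasDerivAt_inside x h).differentiableAt)
      fun h => (hasDerivAt_outside x h).differentiableAt
  · rw [(hasDerivAt_outside x hx).deriv, abs_of_pos hσ]

lemma exists_isExpandingExtension {τ₀ : ℝ → ℝ} (huv : u < v) (hσ : 0 < σ)
    (hτ₀ : ContinuousOn τ₀ (Icc u v)) (heq : EqOn τ₀ τ (Ioo u v))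
    (hmono : MonotoneOn τ (Ioo u v) ∨ AntitoneOn τ (Ioo u v))
    (hd : ∀ x ∈ Ioo u v, σ ≤ |deriv τ x|) : ∃ T, IsExpandingExtension σ u v τ T := by
  rcases hmono with hmono | hanti
  · refine exists_isExpandingExtension_of_le_deriv huv hσ hτ₀ heq fun x hx => ?_
    have : 0 ≤ deriv τ x := by
      rw [← derivWithin_of_isOpen isOpen_Ioo hx]
      exact hmono.derivWithin_nonneg
    exact (hd x hx).trans_eq (abs_of_nonneg this)
  · obtain ⟨T, hT⟩ := exists_isExpandingExtension_of_le_deriv (τ := -τ) huv hσ hτ₀.neg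
      (fun x hx => neg_inj.2 (heq hx)) fun x hx => by
        have : deriv τ x ≤ 0 := by
          rw [← derivWithin_of_isOpen isOpen_Ioo hx]
          exact hanti.derivWithin_nonpos
        rw [deriv.neg, ← abs_of_nonpos this]
        exact hd x hx
    exact ⟨_, hT.neg⟩

end ExpandingExtension

section TransferBranch

variable {σ u v : ℝ} {τ : ℝ → ℝ} {T : ℝ ≃ₜ ℝ}

/-- The contribution of the branch of `τ` on `J` to the Frobenius-Perron operator. -/
def transferBranch (τ : ℝ → ℝ) (J : Set ℝ) (f : ℝ → ℂ) : ℝ → ℂ :=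
  (τ '' J).indicator fun x =>
    f (Function.invFunOn τ J x) / (|deriv τ (Function.invFunOn τ J x)| : ℝ)

lemma transferBranch_apply {J : Set ℝ} (hτ : InjOn τ J) (f : ℝ → ℂ) {z : ℝ} (hz : z ∈ J) :
    transferBranch τ J f (τ z) = |deriv τ z|⁻¹ • f z := by
  rw [transferBranch, indicator_of_mem (mem_image_of_mem τ hz), hτ.leftInvOn_invFunOn hz,
    Complex.real_smul, Complex.ofReal_inv, div_eq_inv_mul]

namespace IsExpandingExtension

variable (h : IsExpandingExtension σ u v τ T)
include h

lemma deriv_eq {z : ℝ} (hz : z ∈ Ioo u v) : deriv T z = deriv τ z :=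
  (h.eqOn.eventuallyEq_of_mem (Ioo_mem_nhds hz.1 hz.2)).deriv_eq

lemma transferBranch_comp (f : ℝ → ℂ) : transferBranch τ (Ioo u v) f ∘ T =
    fun z => |deriv T z|⁻¹ • (Ioo u v).indicator f z := by
  ext z
  by_cases hz : z ∈ Ioo u v
  · rw [Function.comp, h.eqOn hz, transferBranch_apply (h.eqOn.injOn_iff.1 T.injective.injOn) f hz,
      indicator_of_mem hz, h.deriv_eq hz]
  · have hTz : T z ∉ τ '' Ioo u v := by
      rwa [← h.eqOn.image_eq, T.injective.mem_set_image]
    rw [Function.comp, transferBranch, indicator_of_notMem hTz, indicator_of_notMem hz, smul_zero]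

lemma ball_subset_image_ball (hσ : 0 < σ) (z r : ℝ) :
    Metric.ball (T z) r ⊆ T '' Metric.ball z (r / σ) := by
  intro x hx
  refine ⟨T.symm x, ?_, T.apply_symm_apply x⟩
  rw [Metric.mem_ball, lt_div_iff₀' hσ]
  refine (h.mul_dist_le _ _).trans_lt ?_
  rwa [T.apply_symm_apply]

lemma le_abs_deriv {z : ℝ} (hd : DifferentiableAt ℝ T z) : σ ≤ |deriv T z| := by
  refine ge_of_tendsto hd.hasDerivAt.tendsto_slope.abs (eventually_nhdsWithin_of_forall ?_)
  intro y hy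
  rw [slope_def_field, abs_div, le_div_iff₀ (abs_pos.2 (sub_ne_zero.2 hy))]
  exact h.mul_dist_le y z

lemma inv_abs_deriv_le (hσ : 0 < σ) (z : ℝ) : |deriv T z|⁻¹ ≤ σ⁻¹ := by
  by_cases hd : DifferentiableAt ℝ T z
  · exact inv_anti₀ hσ (h.le_abs_deriv hd)
  · simpa [deriv_zero_of_not_differentiableAt hd] using hσ.le

lemma lintegral_eq (F : ℝ → ENNReal) :
    ∫⁻ x, F x = ∫⁻ z, ENNReal.ofReal |deriv T z| * F (T z) := by
  have ae_mem (s : Set ℝ) (hs : s.Finite) : ∀ᵐ x, x ∈ sᶜ := hs.countable.ae_notMem volume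
  have key := lintegral_image_eq_lintegral_abs_deriv_mul (toFinite {u, v}).measurableSet.compl
    (fun z hz => (h.differentiableAt z hz).hasDerivAt.hasDerivWithinAt) T.injective.injOn F
  rwa [image_compl_eq T.bijective, Measure.restrict_eq_self_of_ae_mem (ae_mem _ (toFinite _)),
    Measure.restrict_eq_self_of_ae_mem (ae_mem _ (toFinite _))] at key

lemma ae_deriv_ne_zero (hσ : 0 < σ) : ∀ᵐ z, deriv T z ≠ 0 := by
  filter_upwards [(toFinite {u, v}).countable.ae_notMem volume] with z hz
  exact abs_pos.1 (hσ.trans_le (h.le_abs_deriv (h.differentiableAt z hz)))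

lemma quasiMeasurePreserving_symm : Measure.QuasiMeasurePreserving T.symm := by
  refine ⟨T.symm.measurable, Measure.AbsolutelyContinuous.mk fun s hs hs0 => ?_⟩
  rw [Measure.map_apply T.symm.measurable hs, ← lintegral_indicator_one (T.symm.measurable hs),
    h.lintegral_eq]
  refine lintegral_eq_zero_of_ae_eq_zero ?_
  filter_upwards [measure_eq_zero_iff_ae_notMem.1 hs0] with z hz
  simp [hz]

lemma transferBranch_eq (f : ℝ → ℂ) : transferBranch τ (Ioo u v) f =
    (fun z => |deriv T z|⁻¹ • (Ioo u v).indicator f z) ∘ T.symm := by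
  rw [← h.transferBranch_comp, Function.comp_assoc, T.self_comp_symm, Function.comp_id]

lemma transferBranch_congr_ae {f g : ℝ → ℂ} (hfg : f =ᵐ[volume.restrict (Ioo u v)] g) :
    transferBranch τ (Ioo u v) f =ᵐ[volume] transferBranch τ (Ioo u v) g := by
  rw [h.transferBranch_eq, h.transferBranch_eq]
  refine h.quasiMeasurePreserving_symm.ae_eq_comp ?_
  filter_upwards [(ae_restrict_iff' measurableSet_Ioo).1 hfg] with z hz
  by_cases hzJ : z ∈ Ioo u v
  · simp only [indicator_of_mem hzJ, hz hzJ]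
  · simp only [indicator_of_notMem hzJ]

lemma aestronglyMeasurable_transferBranch {f : ℝ → ℂ}
    (hf : AEStronglyMeasurable f (volume.restrict (Ioo u v))) :
    AEStronglyMeasurable (transferBranch τ (Ioo u v) f) := by
  rw [h.transferBranch_eq]
  refine AEStronglyMeasurable.comp_quasiMeasurePreserving ?_ h.quasiMeasurePreserving_symm
  exact (measurable_deriv T).abs.inv.aestronglyMeasurable.smul
    ((aestronglyMeasurable_indicator_iff measurableSet_Ioo).2 hf)

lemma lintegral_enorm_transferBranch (hσ : 0 < σ) (f : ℝ → ℂ) :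
    ∫⁻ x, ‖transferBranch τ (Ioo u v) f x‖ₑ = ∫⁻ z in Ioo u v, ‖f z‖ₑ := by
  rw [h.lintegral_eq, ← lintegral_indicator measurableSet_Ioo]
  refine lintegral_congr_ae ?_
  filter_upwards [h.ae_deriv_ne_zero hσ] with z hz
  rw [← Function.comp_apply (f := transferBranch τ _ f), h.transferBranch_comp, enorm_smul,
    enorm_indicator_eq_indicator_enorm, Real.enorm_of_nonneg (by positivity), ← mul_assoc,
    ← ENNReal.ofReal_mul (abs_nonneg _), mul_inv_cancel₀ (abs_ne_zero.2 hz), ENNReal.ofReal_one,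
    one_mul]

lemma abs_inv_abs_deriv_sub_le {c y z : ℝ} (hσ : 1 ≤ σ) (hy : y ∈ Ioo u v) (hz : z ∈ Ioo u v)
    (hc : |deriv τ y - deriv τ z| ≤ c) :
    |(|deriv T y|⁻¹) - |deriv T z|⁻¹| ≤ c * |deriv T z|⁻¹ := by
  have one_le : ∀ x ∈ Ioo u v, 1 ≤ |deriv T x| := fun x hx => hσ.trans <|
    h.le_abs_deriv <| h.differentiableAt x <| by simp [hx.1.ne', hx.2.ne]
  have hTy := one_le y hy
  have hTz := one_le z hz
  rw [← h.deriv_eq hy, ← h.deriv_eq hz, abs_sub_comm] at hc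
  rw [inv_sub_inv (by positivity) (by positivity), abs_div, abs_mul, abs_abs, abs_abs,
    ← div_eq_mul_inv]
  gcongr
  · exact (abs_nonneg _).trans hc
  · exact (abs_abs_sub_abs_le _ _).trans hc
  · exact le_mul_of_one_le_left (abs_nonneg _) hTy

lemma oscOn_transferBranch_le (hσ : 0 < σ) (f : ℝ → ℂ) (r z : ℝ) :
    oscOn univ (transferBranch τ (Ioo u v) f) r (T z) ≤
      oscOn univ (fun y => |deriv T y|⁻¹ • (Ioo u v).indicator f y) (r / σ) z := by
  rw [← h.transferBranch_comp]
  refine oscOn_le_oscOn_comp ?_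
  rw [inter_univ, inter_univ]
  exact h.ball_subset_image_ball hσ z r

lemma oscOn_smul_le_of_mem {c ρ z : ℝ} (f : ℝ → ℂ) (hσ : 1 ≤ σ) (hρ : 0 < ρ)
    (hc : ∀ x ∈ Ioo u v, ∀ y ∈ Ioo u v, |x - y| < ρ → |deriv τ x - deriv τ y| ≤ c)
    (hz : z ∈ Ioo u v) :
    oscOn univ (fun y => |deriv T y|⁻¹ • (Ioo u v).indicator f y) ρ z ≤
      ENNReal.ofReal |deriv T z|⁻¹ *
        ((1 + ENNReal.ofReal (2 * c)) * oscOn univ ((Ioo u v).indicator f) ρ z +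
          ENNReal.ofReal (2 * c) * ‖(Ioo u v).indicator f z‖ₑ) := by
  have hc0 : 0 ≤ c := (abs_nonneg _).trans (hc z hz z hz (by simpa))
  refine oscOn_smul_le_of_abs_sub_le hρ (by positivity) hc0 fun y hy hfy => ?_
  have hyJ : y ∈ Ioo u v := mem_of_indicator_ne_zero hfy
  exact h.abs_inv_abs_deriv_sub_le hσ hyJ hz (hc y hyJ z hz hy)

lemma oscOn_smul_le_of_notMem {ρ z : ℝ} (f : ℝ → ℂ) (hσ : 0 < σ) (hρ : 0 < ρ)
    (hz : z ∉ Icc u v) :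
    oscOn univ (fun y => |deriv T y|⁻¹ • (Ioo u v).indicator f y) ρ z ≤
      ENNReal.ofReal |deriv T z|⁻¹ * oscOn univ ((Ioo u v).indicator f) ρ z := by
  rw [h.abs_deriv_eq z hz]
  exact oscOn_smul_le_of_le (fun y => by positivity) (h.inv_abs_deriv_le hσ)
    ⟨z, Metric.mem_ball_self hρ, indicator_of_notMem (fun hzJ => hz (Ioo_subset_Icc_self hzJ)) f⟩

lemma lintegral_oscOn_transferBranch_le {c r : ℝ} (f : ℝ → ℂ) (hσ : 1 ≤ σ) (hr : 0 < r)
    (hc : ∀ x ∈ Ioo u v, ∀ y ∈ Ioo u v, |x - y| < r / σ → |deriv τ x - deriv τ y| ≤ c) :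
    ∫⁻ x, oscOn univ (transferBranch τ (Ioo u v) f) r x ≤
      (1 + ENNReal.ofReal (2 * c)) * (∫⁻ z, oscOn univ ((Ioo u v).indicator f) (r / σ) z) +
        ENNReal.ofReal (2 * c) * ∫⁻ z in Ioo u v, ‖f z‖ₑ := by
  have hσ0 : 0 < σ := one_pos.trans_le hσ
  have hρ : 0 < r / σ := by positivity
  rw [h.lintegral_eq, ← lintegral_indicator measurableSet_Ioo,
    ← lintegral_const_mul' _ _ (by finiteness), ← lintegral_const_mul' _ _ (by finiteness),
    ← lintegral_add_left (measurable_oscOn.const_mul _)]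
  refine lintegral_mono_ae ?_
  filter_upwards [h.ae_deriv_ne_zero hσ0, (toFinite {u, v}).countable.ae_notMem volume]
    with z hz hzuv
  have cancel (X : ENNReal) :
      ENNReal.ofReal |deriv T z| * (ENNReal.ofReal |deriv T z|⁻¹ * X) = X := by
    rw [← mul_assoc, ← ENNReal.ofReal_mul (abs_nonneg _), mul_inv_cancel₀ (abs_ne_zero.2 hz),
      ENNReal.ofReal_one, one_mul]
  rw [← enorm_indicator_eq_indicator_enorm]
  refine (mul_le_mul_right (h.oscOn_transferBranch_le hσ0 f r z) _).trans ?_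
  by_cases hzJ : z ∈ Ioo u v
  · exact (mul_le_mul_right (h.oscOn_smul_le_of_mem f hσ hρ hc hzJ) _).trans_eq (cancel _)
  · have hzI : z ∉ Icc u v := by
      rw [← Icc_sdiff_both] at hzJ
      tauto
    refine (mul_le_mul_right (h.oscOn_smul_le_of_notMem f hσ0 hρ hzI) _).trans ?_
    rw [cancel, one_add_mul, add_assoc]
    exact le_self_add

end IsExpandingExtension

end TransferBranch

section Endpoint

lemma setLIntegral_Ioo_comp_mul_left {c : ℝ} (hc : 0 < c) (b : ℝ) (F : ℝ → ENNReal) :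
    ∫⁻ t in Ioo 0 b, F (c * t) = ENNReal.ofReal c⁻¹ * ∫⁻ y in Ioo 0 (c * b), F y := by
  have image_eq : (c * ·) '' Ioo 0 b = Ioo 0 (c * b) := by rw [image_mul_left_Ioo hc, mul_zero]
  have deriv : ∀ x ∈ Ioo 0 b, HasDerivWithinAt (c * ·) c (Ioo 0 b) x := fun x _ => by
    simpa using ((hasDerivAt_id x).const_mul c).hasDerivWithinAt
  rw [← image_eq, lintegral_image_eq_lintegral_abs_deriv_mul measurableSet_Ioo deriv
    (mul_right_injective₀ hc.ne').injOn, lintegral_const_mul' _ _ (by finiteness), ← mul_assoc,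
    abs_of_pos hc, ← ENNReal.ofReal_mul (by positivity), inv_mul_cancel₀ hc.ne',
    ENNReal.ofReal_one, one_mul]

lemma measurePreserving_isometryEquiv (e : ℝ ≃ᵢ ℝ) : MeasurePreserving e := by
  rw [← hausdorffMeasure_real]
  exact e.measurePreserving_hausdorffMeasure 1

lemma setLIntegral_comp_isometryEquiv (e : ℝ ≃ᵢ ℝ) (s : Set ℝ) (F : ℝ → ENNReal) :
    ∫⁻ t in e ⁻¹' s, F (e t) = ∫⁻ y in s, F y :=
  (measurePreserving_isometryEquiv e).setLIntegral_comp_preimage_emb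
    e.toHomeomorph.measurableEmbedding F s

lemma setLIntegral_Ioo_comp_add_right (b c d : ℝ) (F : ℝ → ENNReal) :
    ∫⁻ t in Ioo b c, F (t + d) = ∫⁻ y in Ioo (b + d) (c + d), F y := by
  have preimage_eq : IsometryEquiv.addRight d ⁻¹' Ioo (b + d) (c + d) = Ioo b c := by
    ext t
    simp
  rw [← preimage_eq]
  exact setLIntegral_comp_isometryEquiv (IsometryEquiv.addRight d) _ F

lemma setLIntegral_Ioo_comp_sub_left (b c d : ℝ) (F : ℝ → ENNReal) :
    ∫⁻ t in Ioo b c, F (d - t) = ∫⁻ y in Ioo (d - c) (d - b), F y := by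
  have preimage_eq : IsometryEquiv.subLeft d ⁻¹' Ioo (d - c) (d - b) = Ioo b c := by
    ext t
    simp [and_comm]
  rw [← preimage_eq]
  exact setLIntegral_comp_isometryEquiv (IsometryEquiv.subLeft d) _ F

lemma setLIntegral_Ioo_add_Ioo_le {b c d : ℝ} (hbc : b ≤ c) (hcd : c ≤ d) (F : ℝ → ENNReal) :
    (∫⁻ x in Ioo b c, F x) + ∫⁻ x in Ioo c d, F x ≤ ∫⁻ x in Ioo b d, F x := by
  rw [← lintegral_union measurableSet_Ioo (Ioo_disjoint_Ioo.2 (by simp [hbc, hcd]))]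
  exact lintegral_mono_set
    (union_subset (Ioo_subset_Ioo_right hcd) (Ioo_subset_Ioo_left hbc))

variable {E : Type*} [NormedAddCommGroup E] {F : ℝ → E} {ρ ρ' R ℓ t : ℝ}

lemma setLIntegral_Iio_oscOn_indicator_le (hℓ : ρ ≤ ℓ) :
    ∫⁻ z in Iio ℓ, oscOn univ ((Ioo 0 (2 * ℓ)).indicator F) ρ z ≤
      (∫⁻ t in Ioo 0 ρ, oscOn univ ((Ioo 0 (2 * ℓ)).indicator F) ρ (-t)) +
      (∫⁻ t in Ioo 0 ρ, oscOn univ ((Ioo 0 (2 * ℓ)).indicator F) ρ t) +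
      ∫⁻ t in Ioo ρ ℓ, oscOn (Ioo 0 (2 * ℓ)) F ρ t := by
  set O := oscOn univ ((Ioo 0 (2 * ℓ)).indicator F) ρ
  have far : ∫⁻ z in Iic (-ρ), O z = 0 := by
    refine setLIntegral_eq_zero measurableSet_Iic fun z hz => oscOn_indicator_eq_zero ?_
    rw [Real.ball_eq_Ioo, Set.disjoint_left]
    intro y hy hy'
    linarith [hy.2, hy'.1, mem_Iic.1 hz]
  have reflect : ∫⁻ z in Ioo (-ρ) 0, O z = ∫⁻ t in Ioo 0 ρ, O (-t) := by
    simpa using (setLIntegral_Ioo_comp_sub_left 0 ρ 0 O).symm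
  have core : ∫⁻ z in Ioo ρ ℓ, O z ≤ ∫⁻ z in Ioo ρ ℓ, oscOn (Ioo 0 (2 * ℓ)) F ρ z := by
    refine setLIntegral_mono measurable_oscOn fun z hz => oscOn_indicator_le_of_ball_subset ?_
    rw [Real.ball_eq_Ioo]
    exact Ioo_subset_Ioo (by linarith [hz.1]) (by linarith [hz.2])
  have cover : Iio ℓ ⊆ Iic (-ρ) ∪ ({0, ρ} ∪ (Ioo (-ρ) 0 ∪ Ioo 0 ρ ∪ Ioo ρ ℓ)) := by
    intro z hz
    simp only [mem_union, mem_Iic, mem_Ioo, mem_insert_iff, mem_singleton_iff, mem_Iio] at hz ⊢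
    grind
  calc _ ≤ _ := lintegral_mono_set cover
    _ ≤ (∫⁻ z in Iic (-ρ), O z) + ((∫⁻ z in {0, ρ}, O z) +
          ((∫⁻ z in Ioo (-ρ) 0, O z) + (∫⁻ z in Ioo 0 ρ, O z) + ∫⁻ z in Ioo ρ ℓ, O z)) := by
      refine (lintegral_union_le _ _ _).trans (add_le_add_right ?_ _)
      refine (lintegral_union_le _ _ _).trans (add_le_add_right ?_ _)
      exact (lintegral_union_le _ _ _).trans (add_le_add_left (lintegral_union_le _ _ _) _)
    _ ≤ _ := by
      rw [far, setLIntegral_measure_zero _ _ ((toFinite {0, ρ}).measure_zero volume), zero_add,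
        zero_add, reflect]
      gcongr

lemma oscOn_indicator_le_rescaled (hρ : 0 < ρ) (hρR : ρ ≤ R) (hR : R ≤ ℓ) (ht : t ∈ Ioo 0 ρ)
    {z : ℝ} (hz : z ≤ t) :
    oscOn univ ((Ioo 0 (2 * ℓ)).indicator F) ρ z ≤
      oscOn (Ioo 0 (2 * ℓ)) F R (R / ρ * t) + ‖F (R / ρ * t)‖ₑ := by
  have le_mul : t ≤ R / ρ * t := le_mul_of_one_le_left ht.1.le ((one_le_div hρ).2 hρR)
  have mul_lt : R / ρ * t < R := by
    rw [div_mul_eq_mul_div, div_lt_iff₀ hρ]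
    exact mul_lt_mul_of_pos_left ht.2 (hρ.trans_le hρR)
  refine oscOn_indicator_le ⟨Metric.mem_ball_self (hρ.trans_le hρR), ?_, ?_⟩ fun y hy => ?_
  · linarith [ht.1]
  · linarith
  · rw [Real.ball_eq_Ioo] at hy ⊢
    exact ⟨by linarith [hy.2.1], by linarith [hy.1.2]⟩

lemma setLIntegral_oscOn_indicator_le_rescaled (hρ : 0 < ρ) (hρR : ρ ≤ R) (hR : R ≤ ℓ)
    {g : ℝ → ℝ} (hg : ∀ t ∈ Ioo 0 ρ, g t ≤ t) :
    ∫⁻ t in Ioo 0 ρ, oscOn univ ((Ioo 0 (2 * ℓ)).indicator F) ρ (g t) ≤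
      ENNReal.ofReal (ρ / R) *
        ((∫⁻ t in Ioo 0 R, oscOn (Ioo 0 (2 * ℓ)) F R t) + ∫⁻ t in Ioo 0 R, ‖F t‖ₑ) := by
  have hR0 : 0 < R := hρ.trans_le hρR
  calc _ ≤ ∫⁻ t in Ioo 0 ρ, (oscOn (Ioo 0 (2 * ℓ)) F R (R / ρ * t) + ‖F (R / ρ * t)‖ₑ) :=
        setLIntegral_mono' measurableSet_Ioo fun t ht =>
          oscOn_indicator_le_rescaled hρ hρR hR ht (hg t ht)
    _ = _ := by
      rw [setLIntegral_Ioo_comp_mul_left (by positivity) ρ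
          fun y => oscOn (Ioo 0 (2 * ℓ)) F R y + ‖F y‖ₑ, inv_div, div_mul_cancel₀ _ hρ.ne',
        lintegral_add_left measurable_oscOn]

/-- An estimate near the endpoint `0` of the interval `(0, 2ℓ)`, uniform over all functions:
extending a function by zero costs no more than a fraction `c` of an oscillation at the scale `ρ₂`
and `c'` times the `L¹`-norm, both taken over the half of the interval next to that endpoint. -/
def EndpointBound (c c' : ENNReal) (ρ ρ₁ ρ₂ ℓ : ℝ) : Prop :=
  ∀ F : ℝ → ℂ, ∫⁻ z in Iio ℓ, oscOn univ ((Ioo 0 (2 * ℓ)).indicator F) ρ z ≤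
    (∫⁻ z in Ioo 0 ℓ, oscOn (Ioo 0 (2 * ℓ)) F ρ₁ z) +
      c * (∫⁻ z in Ioo 0 ℓ, oscOn (Ioo 0 (2 * ℓ)) F ρ₂ z) + c' * ∫⁻ z in Ioo 0 ℓ, ‖F z‖ₑ

lemma endpointBound_of_le (hρ : 0 < ρ) (hρR : ρ ≤ R) (hR : R ≤ ℓ) :
    EndpointBound (ENNReal.ofReal (ρ / R)) (1 + ENNReal.ofReal (ρ / R)) ρ ρ R ℓ := by
  intro F
  set S := Ioo 0 (2 * ℓ)
  have left := setLIntegral_oscOn_indicator_le_rescaled (F := F) hρ hρR hR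
    (g := fun t => -t) fun t ht => by linarith [ht.1]
  have right := setLIntegral_oscOn_indicator_le_rescaled (F := F) hρ le_rfl (hρR.trans hR)
    (g := fun t => t) fun t _ => le_rfl
  rw [div_self hρ.ne', ENNReal.ofReal_one, one_mul] at right
  have near_add_core : (∫⁻ t in Ioo 0 ρ, oscOn S F ρ t) + ∫⁻ t in Ioo ρ ℓ, oscOn S F ρ t ≤
      ∫⁻ t in Ioo 0 ℓ, oscOn S F ρ t :=
    setLIntegral_Ioo_add_Ioo_le hρ.le (hρR.trans hR) _
  refine (setLIntegral_Iio_oscOn_indicator_le (hρR.trans hR)).trans ?_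
  calc _ ≤ ENNReal.ofReal (ρ / R) *
          ((∫⁻ t in Ioo 0 R, oscOn S F R t) + ∫⁻ t in Ioo 0 R, ‖F t‖ₑ) +
        ((∫⁻ t in Ioo 0 ρ, oscOn S F ρ t) + ∫⁻ t in Ioo 0 ρ, ‖F t‖ₑ) +
        ∫⁻ t in Ioo ρ ℓ, oscOn S F ρ t := by gcongr
    _ = ((∫⁻ t in Ioo 0 ρ, oscOn S F ρ t) + ∫⁻ t in Ioo ρ ℓ, oscOn S F ρ t) +
        ENNReal.ofReal (ρ / R) * (∫⁻ t in Ioo 0 R, oscOn S F R t) +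
        ((∫⁻ t in Ioo 0 ρ, ‖F t‖ₑ) + ENNReal.ofReal (ρ / R) * ∫⁻ t in Ioo 0 R, ‖F t‖ₑ) := by ring
    _ ≤ _ := by
      rw [one_add_mul]
      gcongr
      exact hρR.trans hR

lemma endpointBound_two_mul_of_le (hρ : 0 < ρ) (hρR : ρ ≤ R) (hR : R ≤ ℓ) :
    EndpointBound (2 * ENNReal.ofReal (ρ / R)) (2 * ENNReal.ofReal (ρ / R)) ρ ρ R ℓ := by
  intro F
  have left := setLIntegral_oscOn_indicator_le_rescaled (F := F) hρ hρR hR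
    (g := fun t => -t) fun t ht => by linarith [ht.1]
  have right := setLIntegral_oscOn_indicator_le_rescaled (F := F) hρ hρR hR
    (g := fun t => t) fun t _ => le_rfl
  refine (setLIntegral_Iio_oscOn_indicator_le (hρR.trans hR)).trans ?_
  refine (add_le_add_left (add_le_add left right) _).trans ?_
  rw [← two_mul, ← mul_assoc, mul_add, add_comm, ← add_assoc]
  gcongr

lemma setLIntegral_enorm_le_shift {b c : ℝ} (hρ : 0 < ρ) (hρ' : ρ < ρ') (hb : 0 ≤ b)
    (hc : c + 2 * ρ ≤ 2 * ℓ) :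
    ∫⁻ x in Ioo b c, ‖F x‖ₑ ≤ (∫⁻ x in Ioo (b + ρ) (c + ρ), oscOn (Ioo 0 (2 * ℓ)) F ρ' x) +
      ∫⁻ x in Ioo (b + 2 * ρ) (c + 2 * ρ), ‖F x‖ₑ := by
  have near : ∀ x ∈ Ioo (b + ρ) (c + ρ),
      ‖F (x + -ρ)‖ₑ ≤ oscOn (Ioo 0 (2 * ℓ)) F ρ' x + ‖F (x + ρ)‖ₑ := by
    intro x hx
    refine enorm_le_oscOn_add ?_ ?_
    all_goals simp only [Real.ball_eq_Ioo, mem_inter_iff, mem_Ioo] at *; grind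
  have left := setLIntegral_Ioo_comp_add_right (b + ρ) (c + ρ) (-ρ) fun x => ‖F x‖ₑ
  have right := setLIntegral_Ioo_comp_add_right (b + ρ) (c + ρ) ρ fun x => ‖F x‖ₑ
  rw [add_neg_cancel_right, add_neg_cancel_right] at left
  rw [add_assoc b, add_assoc c, ← two_mul] at right
  rw [← left, ← right, ← lintegral_add_left measurable_oscOn]
  exact setLIntegral_mono' measurableSet_Ioo near

lemma setLIntegral_enorm_le_iterate_shift (hρ : 0 < ρ) (hρ' : ρ < ρ') (n : ℕ)
    (hn : (2 * n + 2) * ρ ≤ 2 * ℓ) :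
    ∫⁻ x in Ioo 0 (2 * ρ), ‖F x‖ₑ ≤
      (∫⁻ x in Ioo ρ ((2 * n + 1) * ρ), oscOn (Ioo 0 (2 * ℓ)) F ρ' x) +
        ∫⁻ x in Ioo (2 * n * ρ) ((2 * n + 2) * ρ), ‖F x‖ₑ := by
  induction n with
  | zero => simp
  | succ n ih =>
    push_cast at hn ⊢
    have shift := setLIntegral_enorm_le_shift (F := F) (b := 2 * n * ρ) (c := (2 * n + 2) * ρ)
      hρ hρ' (by positivity) (by linarith)
    have glue := setLIntegral_Ioo_add_Ioo_le (b := ρ) (c := (2 * n + 1) * ρ)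
      (d := (2 * n + 3) * ρ) (by nlinarith) (by linarith) (oscOn (Ioo 0 (2 * ℓ)) F ρ')
    calc _ ≤ _ := (ih (by linarith)).trans (add_le_add_right shift _)
      _ = (∫⁻ x in Ioo ρ ((2 * n + 1) * ρ), oscOn (Ioo 0 (2 * ℓ)) F ρ' x) +
          (∫⁻ x in Ioo ((2 * n + 1) * ρ) ((2 * n + 3) * ρ), oscOn (Ioo 0 (2 * ℓ)) F ρ' x) +
          ∫⁻ x in Ioo (2 * (n + 1) * ρ) ((2 * (n + 1) + 2) * ρ), ‖F x‖ₑ := by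
        rw [add_assoc]
        ring_nf
      _ ≤ _ := by
        refine (add_le_add_left glue _).trans_eq ?_
        ring_nf

lemma sum_setLIntegral_Ioo_le (hρ : 0 ≤ ρ) (N : ℕ) (G : ℝ → ENNReal) :
    ∑ n ∈ Finset.range N, ∫⁻ x in Ioo (2 * n * ρ) ((2 * n + 2) * ρ), G x ≤
      ∫⁻ x in Ioo 0 (2 * N * ρ), G x := by
  induction N with
  | zero => simp
  | succ N ih =>
    rw [Finset.sum_range_succ]
    push_cast
    refine (add_le_add_left ih _).trans ?_
    refine (setLIntegral_Ioo_add_Ioo_le (by positivity) (by linarith) _).trans_eq ?_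
    ring_nf

-- Averaging over `N` translates makes the weight of the `L¹`-norm as small as we please.
lemma setLIntegral_enorm_le_average (hρ : 0 < ρ) (hρ' : ρ < ρ') {N : ℕ} (hN : 0 < N)
    (hNℓ : 2 * N * ρ ≤ ℓ) :
    ∫⁻ x in Ioo 0 (2 * ρ), ‖F x‖ₑ ≤ (∫⁻ x in Ioo ρ ℓ, oscOn (Ioo 0 (2 * ℓ)) F ρ' x) +
      (N : ENNReal)⁻¹ * ∫⁻ x in Ioo 0 ℓ, ‖F x‖ₑ := by
  have hN0 : (N : ENNReal) ≠ 0 := by exact_mod_cast hN.ne'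
  have term : ∀ n ∈ Finset.range N, ∫⁻ x in Ioo 0 (2 * ρ), ‖F x‖ₑ ≤
      (∫⁻ x in Ioo ρ ℓ, oscOn (Ioo 0 (2 * ℓ)) F ρ' x) +
        ∫⁻ x in Ioo (2 * n * ρ) ((2 * n + 2) * ρ), ‖F x‖ₑ := by
    intro n hn
    have hnN : (n : ℝ) + 1 ≤ N := by exact_mod_cast Finset.mem_range.1 hn
    refine (setLIntegral_enorm_le_iterate_shift (ℓ := ℓ) hρ hρ' n (by nlinarith)).trans ?_
    gcongr
    nlinarith
  have sum_term := Finset.sum_le_sum term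
  rw [Finset.sum_add_distrib, Finset.sum_const, Finset.sum_const, Finset.card_range, nsmul_eq_mul,
    nsmul_eq_mul] at sum_term
  refine (ENNReal.mul_le_mul_iff_right hN0 (ENNReal.natCast_ne_top N)).1 (sum_term.trans ?_)
  rw [mul_add, ← mul_assoc, ENNReal.mul_inv_cancel hN0 (ENNReal.natCast_ne_top N), one_mul]
  gcongr
  exact (sum_setLIntegral_Ioo_le hρ.le N _).trans (lintegral_mono_set (Ioo_subset_Ioo_right hNℓ))

lemma setLIntegral_oscOn_indicator_neg_le (hρ' : ρ < ρ') (hℓ : ρ ≤ ℓ) :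
    ∫⁻ t in Ioo 0 ρ, oscOn univ ((Ioo 0 (2 * ℓ)).indicator F) ρ (-t) ≤
      (∫⁻ t in Ioo 0 ρ, oscOn (Ioo 0 (2 * ℓ)) F ρ' t) + ∫⁻ t in Ioo 0 ρ, ‖F t‖ₑ := by
  have reflect : ∫⁻ t in Ioo 0 ρ, ‖F t‖ₑ = ∫⁻ t in Ioo 0 ρ, ‖F (ρ - t)‖ₑ := by
    simpa using (setLIntegral_Ioo_comp_sub_left 0 ρ ρ fun t => ‖F t‖ₑ).symm
  rw [reflect, ← lintegral_add_left measurable_oscOn]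
  refine setLIntegral_mono' measurableSet_Ioo fun t ht => oscOn_indicator_le ⟨?_, ?_⟩ ?_
  · rw [Real.ball_eq_Ioo]
    exact ⟨by linarith [ht.2], by linarith [ht.1]⟩
  · exact ⟨by linarith [ht.2], by linarith [ht.1, ht.2]⟩
  · rintro y ⟨hy, hy'⟩
    rw [Real.ball_eq_Ioo] at hy ⊢
    exact ⟨by linarith [hy'.1, ht.2], by linarith [hy.2, ht.1]⟩

lemma setLIntegral_oscOn_indicator_pos_le (hρ' : ρ < ρ') (hℓ : ρ ≤ ℓ) :
    ∫⁻ t in Ioo 0 ρ, oscOn univ ((Ioo 0 (2 * ℓ)).indicator F) ρ t ≤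
      (∫⁻ t in Ioo 0 ρ, oscOn (Ioo 0 (2 * ℓ)) F ρ' t) + ∫⁻ t in Ioo ρ (2 * ρ), ‖F t‖ₑ := by
  have shift : ∫⁻ t in Ioo ρ (2 * ρ), ‖F t‖ₑ = ∫⁻ t in Ioo 0 ρ, ‖F (t + ρ)‖ₑ := by
    simpa [two_mul] using (setLIntegral_Ioo_comp_add_right 0 ρ ρ fun t => ‖F t‖ₑ).symm
  rw [shift, ← lintegral_add_left measurable_oscOn]
  refine setLIntegral_mono' measurableSet_Ioo fun t ht => oscOn_indicator_le ⟨?_, ?_⟩ ?_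
  · rw [Real.ball_eq_Ioo]
    exact ⟨by linarith [ht.1, ht.2], by linarith⟩
  · exact ⟨by linarith [ht.1, ht.2], by linarith [ht.2]⟩
  · exact inter_subset_left.trans (Metric.ball_subset_ball hρ'.le)

lemma endpointBound_of_lt (hρ : 0 < ρ) (hρ' : ρ < ρ') {N : ℕ} (hN : 0 < N)
    (hNℓ : 2 * N * ρ ≤ ℓ) : EndpointBound 1 (N : ENNReal)⁻¹ ρ ρ' ρ' ℓ := by
  intro F
  set S := Ioo 0 (2 * ℓ)
  set Ω := oscOn S F ρ'
  have hρℓ : ρ ≤ ℓ := by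
    have : (1 : ℝ) ≤ N := by exact_mod_cast hN
    nlinarith
  have near : (∫⁻ t in Ioo 0 ρ, ‖F t‖ₑ) + ∫⁻ t in Ioo ρ (2 * ρ), ‖F t‖ₑ ≤
      ∫⁻ t in Ioo 0 (2 * ρ), ‖F t‖ₑ :=
    setLIntegral_Ioo_add_Ioo_le hρ.le (by linarith) _
  have near_add_core : (∫⁻ t in Ioo 0 ρ, Ω t) + ∫⁻ t in Ioo ρ ℓ, Ω t ≤ ∫⁻ t in Ioo 0 ℓ, Ω t :=
    setLIntegral_Ioo_add_Ioo_le hρ.le hρℓ _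
  calc _ ≤ ((∫⁻ t in Ioo 0 ρ, Ω t) + ∫⁻ t in Ioo 0 ρ, ‖F t‖ₑ) +
        ((∫⁻ t in Ioo 0 ρ, Ω t) + ∫⁻ t in Ioo ρ (2 * ρ), ‖F t‖ₑ) + ∫⁻ t in Ioo ρ ℓ, Ω t := by
        refine (setLIntegral_Iio_oscOn_indicator_le hρℓ).trans ?_
        refine add_le_add (add_le_add ?_ ?_) ?_
        · exact setLIntegral_oscOn_indicator_neg_le hρ' hρℓ
        · exact setLIntegral_oscOn_indicator_pos_le hρ' hρℓ
        · exact lintegral_mono fun t => oscOn_mono subset_rfl hρ'.le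
    _ = ((∫⁻ t in Ioo 0 ρ, Ω t) + ∫⁻ t in Ioo ρ ℓ, Ω t) + ((∫⁻ t in Ioo 0 ρ, Ω t) +
        ((∫⁻ t in Ioo 0 ρ, ‖F t‖ₑ) + ∫⁻ t in Ioo ρ (2 * ρ), ‖F t‖ₑ)) := by ring
    _ ≤ (∫⁻ t in Ioo 0 ℓ, Ω t) + ((∫⁻ t in Ioo 0 ρ, Ω t) +
        ((∫⁻ t in Ioo ρ ℓ, Ω t) + (N : ENNReal)⁻¹ * ∫⁻ t in Ioo 0 ℓ, ‖F t‖ₑ)) := by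
        exact add_le_add near_add_core (add_le_add_right
          (near.trans (setLIntegral_enorm_le_average hρ hρ' hN hNℓ)) _)
    _ ≤ _ := by
        rw [one_mul, ← add_assoc (∫⁻ t in Ioo 0 ρ, Ω t), ← add_assoc]
        gcongr

end Endpoint

section Partition

variable {c c' : ENNReal} {ρ ρ₁ ρ₂ u v : ℝ}

lemma EndpointBound.setLIntegral_preimage_le {ℓ : ℝ} (h : EndpointBound c c' ρ ρ₁ ρ₂ ℓ)
    (e : ℝ ≃ᵢ ℝ) (f : ℝ → ℂ) {s A B : Set ℝ} (hs : e ⁻¹' s = Ioo 0 (2 * ℓ))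
    (hA : e ⁻¹' A = Iio ℓ) (hB : e ⁻¹' B = Ioo 0 ℓ) :
    ∫⁻ z in A, oscOn univ (s.indicator f) ρ z ≤
      (∫⁻ z in B, oscOn s f ρ₁ z) + c * (∫⁻ z in B, oscOn s f ρ₂ z) + c' * ∫⁻ z in B, ‖f z‖ₑ := by
  have bound := h (f ∘ e)
  have indicator_eq : (Ioo 0 (2 * ℓ)).indicator (f ∘ e) = s.indicator f ∘ e := by
    rw [← hs]
    exact funext fun _ => indicator_comp_right e
  have univ_osc : ∀ z, oscOn univ (s.indicator f ∘ e) ρ z = oscOn univ (s.indicator f) ρ (e z) :=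
    oscOn_comp_isometryEquiv (s := univ) e
  have osc_comp : ∀ R z, oscOn (Ioo 0 (2 * ℓ)) (f ∘ e) R z = oscOn s f R (e z) := fun R z => by
    rw [← hs, oscOn_comp_isometryEquiv]
  simp only [indicator_eq, univ_osc, osc_comp, Function.comp_apply, ← hA, ← hB] at bound
  rwa [setLIntegral_comp_isometryEquiv e A, setLIntegral_comp_isometryEquiv e B,
    setLIntegral_comp_isometryEquiv e B, setLIntegral_comp_isometryEquiv e B (‖f ·‖ₑ)] at bound

lemma EndpointBound.lintegral_oscOn_indicator_Ioo_le (huv : u < v)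
    (h : EndpointBound c c' ρ ρ₁ ρ₂ ((v - u) / 2)) (f : ℝ → ℂ) :
    ∫⁻ z, oscOn univ ((Ioo u v).indicator f) ρ z ≤
      (∫⁻ z in Ioo u v, oscOn (Ioo u v) f ρ₁ z) + c * (∫⁻ z in Ioo u v, oscOn (Ioo u v) f ρ₂ z) +
        c' * ∫⁻ z in Ioo u v, ‖f z‖ₑ := by
  set m := (u + v) / 2
  set O := oscOn univ ((Ioo u v).indicator f) ρ
  have left := h.setLIntegral_preimage_le (IsometryEquiv.addLeft u) f
    (s := Ioo u v) (A := Iio m) (B := Ioo u m)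
    (by ext; simp only [mem_preimage, IsometryEquiv.addLeft_apply, mem_Ioo]; grind)
    (by ext; simp only [mem_preimage, IsometryEquiv.addLeft_apply, mem_Iio]; grind)
    (by ext; simp only [mem_preimage, IsometryEquiv.addLeft_apply, mem_Ioo]; grind)
  have right := h.setLIntegral_preimage_le (IsometryEquiv.subLeft v) f
    (s := Ioo u v) (A := Ioi m) (B := Ioo m v)
    (by ext; simp only [mem_preimage, IsometryEquiv.subLeft_apply, mem_Ioo]; grind)
    (by ext; simp only [mem_preimage, IsometryEquiv.subLeft_apply, mem_Ioi, mem_Iio]; grind)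
    (by ext; simp only [mem_preimage, IsometryEquiv.subLeft_apply, mem_Ioo]; grind)
  have glue := setLIntegral_Ioo_add_Ioo_le (b := u) (c := m) (d := v) (by grind) (by grind)
  calc ∫⁻ z, O z = ∫⁻ z in Iio m ∪ Ioi m, O z := by
        rw [Iio_union_Ioi, restrict_compl_singleton]
    _ ≤ (∫⁻ z in Iio m, O z) + ∫⁻ z in Ioi m, O z := lintegral_union_le _ _ _
    _ ≤ _ := add_le_add left right
    _ = ((∫⁻ z in Ioo u m, oscOn (Ioo u v) f ρ₁ z) + ∫⁻ z in Ioo m v, oscOn (Ioo u v) f ρ₁ z) +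
        c * ((∫⁻ z in Ioo u m, oscOn (Ioo u v) f ρ₂ z) +
          ∫⁻ z in Ioo m v, oscOn (Ioo u v) f ρ₂ z) +
        c' * ((∫⁻ z in Ioo u m, ‖f z‖ₑ) + ∫⁻ z in Ioo m v, ‖f z‖ₑ) := by ring
    _ ≤ _ := add_le_add (add_le_add (glue _) (mul_le_mul_right (glue _) _))
        (mul_le_mul_right (glue _) _)

variable {q : ℕ} {a : Fin (q + 1) → ℝ}

lemma exists_pos_le_half_length (ha : StrictMono a) :
    ∃ γ : ℝ, 0 < γ ∧ ∀ i : Fin q, γ ≤ (a i.succ - a i.castSucc) / 2 := by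
  rcases isEmpty_or_nonempty (Fin q) with hq | hq
  · exact ⟨1, one_pos, hq.elim⟩
  · obtain ⟨i, hi⟩ := Finite.exists_min fun i : Fin q => (a i.succ - a i.castSucc) / 2
    exact ⟨_, half_pos (sub_pos.2 (ha i.castSucc_lt_succ)), hi⟩

lemma pairwise_disjoint_piece (ha : Monotone a) :
    Pairwise fun i j => Disjoint (piece a i) (piece a j) := fun i j hij => by
  have disjoint_succ := ha.pairwise_disjoint_on_Ioo_succ ((Fin.castSucc_injective q).ne hij)
  simpa only [piece, Function.onFun, Fin.orderSucc_castSucc] using disjoint_succ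

lemma piece_subset_Icc (ha : Monotone a) (h₀ : a 0 = 0) (h₁ : a (Fin.last q) = 1)
    (i : Fin q) : piece a i ⊆ Icc 0 1 := by
  rw [← h₀, ← h₁]
  exact Ioo_subset_Icc_self.trans (Icc_subset_Icc (ha (Fin.zero_le _)) (ha (Fin.le_last _)))

lemma sum_setLIntegral_piece_le (ha : Monotone a) (h₀ : a 0 = 0) (h₁ : a (Fin.last q) = 1)
    (F : ℝ → ENNReal) :
    ∑ i, ∫⁻ z in piece a i, F z ≤ ∫⁻ z, F z ∂mI := by
  rw [← tsum_fintype (L := .unconditional _), ← lintegral_iUnion (s := piece a)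
    (fun _ => measurableSet_Ioo) (pairwise_disjoint_piece ha)]
  exact lintegral_mono_set (iUnion_subset (piece_subset_Icc ha h₀ h₁))

lemma sum_lintegral_oscOn_indicator_piece_le (ha : StrictMono a) (h₀ : a 0 = 0)
    (h₁ : a (Fin.last q) = 1)
    (h : ∀ i : Fin q, EndpointBound c c' ρ ρ₁ ρ₂ ((a i.succ - a i.castSucc) / 2)) (f : ℝ → ℂ) :
    ∑ i, ∫⁻ z, oscOn univ ((piece a i).indicator f) ρ z ≤
      oscOne f ρ₁ + c * oscOne f ρ₂ + c' * normOne f := by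
  have sum_osc : ∀ R, ∑ i, ∫⁻ z in piece a i, oscOn (piece a i) f R z ≤ oscOne f R := by
    intro R
    rw [oscOne, osc_eq_oscOn]
    refine (Finset.sum_le_sum fun i _ => ?_).trans (sum_setLIntegral_piece_le ha.monotone h₀ h₁ _)
    exact lintegral_mono fun z => oscOn_mono (piece_subset_Icc ha.monotone h₀ h₁ i) le_rfl
  calc _ ≤ ∑ i, ((∫⁻ z in piece a i, oscOn (piece a i) f ρ₁ z) +
          c * (∫⁻ z in piece a i, oscOn (piece a i) f ρ₂ z) + c' * ∫⁻ z in piece a i, ‖f z‖ₑ) :=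
        Finset.sum_le_sum fun i _ =>
          (h i).lintegral_oscOn_indicator_Ioo_le (ha i.castSucc_lt_succ) f
    _ ≤ _ := by
        simp only [Finset.sum_add_distrib, ← Finset.mul_sum]
        gcongr
        · exact sum_osc ρ₁
        · exact sum_osc ρ₂
        · exact sum_setLIntegral_piece_le ha.monotone h₀ h₁ _

end Partition

section Cutoff

variable {A p r s β K : ℝ} {q : ℕ} {a : Fin (q + 1) → ℝ}

lemma oscOne_le_rpow_mul_varFun (f : ℝ → ℂ) (hr : 0 < r) (hrA : r ≤ A) :
    oscOne f r ≤ ENNReal.ofReal (r ^ (1 / p)) * varFun A p f := by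
  rw [mul_comm, ← ENNReal.div_le_iff (ENNReal.ofReal_pos.2 (by positivity)).ne'
    ENNReal.ofReal_ne_top]
  exact le_iSup₂ (f := fun r _ => oscOne f r / ENNReal.ofReal (r ^ (1 / p))) r ⟨hr, hrA⟩

/-- A variation estimate, uniform over all functions `f`, for the pieces of `f` on the intervals of
a partition, each extended by zero and measured at scales contracted by the factor `s`. -/
def CutoffBound (a : Fin (q + 1) → ℝ) (A p s β K : ℝ) : Prop :=
  ∀ (f : ℝ → ℂ) (r : ℝ), 0 < r → r ≤ A →
    ∑ i, ∫⁻ z, oscOn univ ((piece a i).indicator f) (r / s) z ≤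
      ENNReal.ofReal (r ^ (1 / p)) *
        (ENNReal.ofReal β * varFun A p f + ENNReal.ofReal K * normOne f)

lemma sum_lintegral_oscOn_indicator_piece_le_varFun (ha : StrictMono a) (h₀ : a 0 = 0)
    (h₁ : a (Fin.last q) = 1) {c c' ρ ρ₁ ρ₂ : ℝ} (hρ₁ : ρ₁ ∈ Ioc 0 A) (hρ₂ : ρ₂ ∈ Ioc 0 A)
    (h : ∀ i : Fin q, EndpointBound (ENNReal.ofReal c) (ENNReal.ofReal c') ρ ρ₁ ρ₂
      ((a i.succ - a i.castSucc) / 2))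
    (hr : 0 ≤ r) (hc : 0 ≤ c) (hβ : ρ₁ ^ (1 / p) + c * ρ₂ ^ (1 / p) ≤ r ^ (1 / p) * β)
    (hK : c' ≤ r ^ (1 / p) * K) (f : ℝ → ℂ) :
    ∑ i, ∫⁻ z, oscOn univ ((piece a i).indicator f) ρ z ≤
      ENNReal.ofReal (r ^ (1 / p)) *
        (ENNReal.ofReal β * varFun A p f + ENNReal.ofReal K * normOne f) := by
  have hρ₁0 := hρ₁.1
  have hρ₂0 := hρ₂.1
  calc _ ≤ oscOne f ρ₁ + ENNReal.ofReal c * oscOne f ρ₂ + ENNReal.ofReal c' * normOne f :=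
        sum_lintegral_oscOn_indicator_piece_le ha h₀ h₁ h f
    _ ≤ ENNReal.ofReal (ρ₁ ^ (1 / p)) * varFun A p f +
          ENNReal.ofReal c * (ENNReal.ofReal (ρ₂ ^ (1 / p)) * varFun A p f) +
          ENNReal.ofReal c' * normOne f := by
        gcongr
        · exact oscOne_le_rpow_mul_varFun f hρ₁.1 hρ₁.2
        · exact oscOne_le_rpow_mul_varFun f hρ₂.1 hρ₂.2
    _ = ENNReal.ofReal (ρ₁ ^ (1 / p) + c * ρ₂ ^ (1 / p)) * varFun A p f +
          ENNReal.ofReal c' * normOne f := by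
        rw [ENNReal.ofReal_add (by positivity) (by positivity), ENNReal.ofReal_mul hc]
        ring
    _ ≤ ENNReal.ofReal (r ^ (1 / p) * β) * varFun A p f +
          ENNReal.ofReal (r ^ (1 / p) * K) * normOne f := by gcongr
    _ = _ := by
        rw [ENNReal.ofReal_mul (by positivity), ENNReal.ofReal_mul (by positivity)]
        ring

lemma div_mul_rpow_le {ε η : ℝ} (hr : 0 < r) (hA : 0 < A) (hε : ε ≤ 1) (h : r ≤ η * A) :
    r / A * A ^ ε ≤ η ^ (1 - ε) * r ^ ε := by
  have split : r / A * A ^ ε = (r / A) ^ (1 - ε) * r ^ ε := by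
    rw [Real.rpow_sub (by positivity), Real.rpow_one, Real.div_rpow hr.le hA.le]
    field_simp
  rw [split]
  gcongr
  exact (div_le_iff₀ hA).2 h

lemma div_rpow_add_mul_le {ε k : ℝ} (hr : 0 ≤ r) (hs : 0 ≤ s)
    (h : k * (r / A * A ^ ε) ≤ r ^ ε) :
    (r / s) ^ ε + k * (r / s / A) * A ^ ε ≤ r ^ ε * (1 / s ^ ε + 1 / s) := by
  calc _ = r ^ ε * (1 / s ^ ε) + k * (r / A * A ^ ε) * (1 / s) := by
        rw [Real.div_rpow hr hs]
        ring
    _ ≤ _ := by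
        rw [mul_add]
        gcongr

variable (ha : StrictMono a) (h₀ : a 0 = 0) (h₁ : a (Fin.last q) = 1) {γ : ℝ}
  (hγ : ∀ i : Fin q, γ ≤ (a i.succ - a i.castSucc) / 2)
include ha h₀ h₁ hγ

lemma cutoffBound_one (hs : 1 < s) (hβ : 2 / s < β) (hβ₂ : β ≤ 2) (hA : 0 < A)
    (hAγ : 4 * A ≤ γ) : CutoffBound a A 1 s β A⁻¹ := by
  intro f r hr hrA
  set N := ⌈A / r⌉₊
  have hβ₀ : 0 < β := lt_trans (by positivity) hβ
  have hN : 0 < N := Nat.ceil_pos.2 (by positivity)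
  have hN_ge : A / r ≤ N := Nat.le_ceil _
  have hN_le : N * r ≤ 2 * A := by
    have : (N : ℝ) * r < (A / r + 1) * r := by gcongr; exact Nat.ceil_lt_add_one (by positivity)
    rw [add_mul, div_mul_cancel₀ _ hr.ne'] at this
    linarith
  have hNγ : 2 * N * (r / s) ≤ γ := by
    have : N * (r / s) ≤ N * r := by gcongr; exact div_le_self hr.le hs.le
    linarith
  have scale_lt : r / s < β / 2 * r := by
    rw [div_eq_mul_inv, mul_comm]
    gcongr
    grind
  have scale_mem : β / 2 * r ∈ Ioc 0 A := ⟨by positivity, by nlinarith⟩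
  have hK : (N : ℝ)⁻¹ ≤ r * A⁻¹ := by
    rw [← div_eq_mul_inv, ← inv_div]
    exact inv_anti₀ (by positivity) hN_ge
  refine sum_lintegral_oscOn_indicator_piece_le_varFun ha h₀ h₁ (c := 1) (c' := (N : ℝ)⁻¹)
    scale_mem scale_mem (fun i => ?_) hr.le zero_le_one ?_ (by simpa using hK) f
  · rw [ENNReal.ofReal_one, ENNReal.ofReal_inv_of_pos (by positivity), ENNReal.ofReal_natCast]
    exact endpointBound_of_lt (by positivity) scale_lt hN (hNγ.trans (hγ i))
  · simp only [div_one, Real.rpow_one]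
    linarith

-- The loss `1 + r / (s * A)` in front of the `L¹`-norm is harmless while `r` is comparable to `A`;
-- for smaller `r` one doubles instead, the factor `2` being absorbed by `(r / A) ^ (1 - 1 / p)`.
lemma cutoffBound_of_one_lt (hp : 1 < p) (hs : 1 < s) (hA : 0 < A) (hAγ : A ≤ γ) {η : ℝ}
    (hη₀ : 0 < η) (hη₁ : η ≤ 1) (hη : η ^ (1 - 1 / p) ≤ 1 / 2) :
    CutoffBound a A p s (1 / s ^ (1 / p) + 1 / s) (2 / (η * A) ^ (1 / p)) := by
  intro f r hr hrA
  set ε := 1 / p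
  have hε : ε ≤ 1 := by rw [div_le_one (by linarith)]; exact hp.le
  have hε₀ : 0 ≤ ε := by positivity
  have hs₀ : 0 ≤ s := zero_le_one.trans hs.le
  have scale_le : r / s ≤ A := (div_le_self hr.le hs.le).trans hrA
  have scale_mem : r / s ∈ Ioc 0 A := ⟨by positivity, scale_le⟩
  have ratio_le : r / s / A ≤ r / A := by gcongr; exact div_le_self hr.le hs.le
  rcases le_or_gt (η * A) r with large | small
  · refine sum_lintegral_oscOn_indicator_piece_le_varFun ha h₀ h₁ (c := r / s / A)
      (c' := 1 + r / s / A) scale_mem ⟨hA, le_rfl⟩ (fun i => ?_) hr.le (by positivity) ?_ ?_ f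
    · rw [ENNReal.ofReal_add zero_le_one (by positivity), ENNReal.ofReal_one]
      exact endpointBound_of_le (by positivity) scale_le (hAγ.trans (hγ i))
    · have := div_mul_rpow_le (η := 1) hr hA hε (by linarith)
      rw [Real.one_rpow] at this
      simpa only [one_mul] using div_rpow_add_mul_le (k := 1) hr.le hs₀ (by linarith)
    · have ratio_le_one : r / A ≤ 1 := (div_le_one hA).2 hrA
      have : (η * A) ^ ε ≤ r ^ ε := Real.rpow_le_rpow (by positivity) large hε₀
      rw [← mul_div_assoc, le_div_iff₀ (by positivity)]
      nlinarith [show 0 < (η * A) ^ ε by positivity]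
  · have half := (div_mul_rpow_le hr hA hε small.le).trans
      (mul_le_mul_of_nonneg_right hη (by positivity))
    refine sum_lintegral_oscOn_indicator_piece_le_varFun ha h₀ h₁ (c := 2 * (r / s / A))
      (c' := 2 * (r / s / A)) scale_mem ⟨hA, le_rfl⟩ (fun i => ?_) hr.le (by positivity) ?_ ?_ f
    · rw [ENNReal.ofReal_mul zero_le_two, ENNReal.ofReal_ofNat]
      exact endpointBound_two_mul_of_le (by positivity) scale_le (hAγ.trans (hγ i))
    · exact div_rpow_add_mul_le hr.le hs₀ (by linarith)
    · have : r / s / A * (η * A) ^ ε ≤ r / A * A ^ ε := by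
        gcongr
        exact mul_le_of_le_one_left hA.le hη₁
      rw [← mul_div_assoc (r ^ ε), le_div_iff₀ (by positivity)]
      nlinarith [show 0 < r ^ ε by positivity]

omit hγ in
lemma exists_cutoffBound (hp : 1 ≤ p) (hs₁ : 1 < s) (hs : 1 / s ^ (1 / p) + 1 / s < 1) :
    ∃ β A₁ : ℝ, 0 < β ∧ β < 1 ∧ 0 < A₁ ∧ ∀ A, 0 < A → A ≤ A₁ →
      ∃ K, 0 < K ∧ CutoffBound a A p s β K := by
  obtain ⟨γ, hγ₀, hγ⟩ := exists_pos_le_half_length ha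
  have : 0 < s := one_pos.trans hs₁
  rcases hp.eq_or_lt with rfl | hp
  · have hs₂ : 2 / s < 1 := by
      rw [div_one, Real.rpow_one] at hs
      linarith [add_div 1 1 s]
    exact ⟨(2 / s + 1) / 2, γ / 4, by positivity, by linarith, by positivity, fun A hA hAγ =>
      ⟨A⁻¹, by positivity,
        cutoffBound_one ha h₀ h₁ hγ hs₁ (by linarith) (by linarith) hA (by linarith)⟩⟩
  · set η : ℝ := (1 / 2) ^ (1 / (1 - 1 / p))
    have exponent_pos : 0 < 1 - 1 / p := by
      rw [sub_pos, div_lt_one (by linarith)]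
      exact hp
    have hη₁ : η ≤ 1 := Real.rpow_le_one (by norm_num) (by norm_num) (by positivity)
    have hη : η ^ (1 - 1 / p) = 1 / 2 := by
      rw [← Real.rpow_mul (by norm_num), one_div_mul_cancel exponent_pos.ne', Real.rpow_one]
    exact ⟨_, γ, by positivity, hs, hγ₀, fun A hA hAγ => ⟨2 / (η * A) ^ (1 / p), by positivity,
      cutoffBound_of_one_lt ha h₀ h₁ hγ hp hs₁ hA hAγ (by positivity) hη₁ hη.le⟩⟩

end Cutoff

section Operator

variable {A p : ℝ} {q : ℕ} {a : Fin (q + 1) → ℝ} {τ : ℝ → ℝ} {f g : ℝ → ℂ}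

lemma varFun_le {c : ENNReal}
    (h : ∀ r, 0 < r → r ≤ A → oscOne f r ≤ ENNReal.ofReal (r ^ (1 / p)) * c) :
    varFun A p f ≤ c :=
  iSup₂_le fun r hr => ENNReal.div_le_of_le_mul' (h r hr.1 hr.2)

lemma var_le_varFun (h : g =ᵐ[mI] f) : var A p f ≤ varFun A p g :=
  iInf₂_le (f := fun g (_ : g =ᵐ[mI] f) => varFun A p g) g h

lemma normOne_congr (h : f =ᵐ[mI] g) : normOne f = normOne g :=
  lintegral_congr_ae (h.mono fun x hx => by simp only [hx])

lemma var_map_le {Φ : (ℝ → ℂ) → ℝ → ℂ} {c c' : ENNReal} (hc₀ : c ≠ 0) (hc : c ≠ ⊤)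
    (hΦ : ∀ f g, f =ᵐ[mI] g → Φ f =ᵐ[mI] Φ g)
    (h : ∀ f, varFun A p (Φ f) ≤ c * varFun A p f + c' * normOne f) (f : ℝ → ℂ) :
    var A p (Φ f) ≤ c * var A p f + c' * normOne f := by
  simp only [var, ENNReal.mul_iInf_of_ne hc₀ hc, ENNReal.iInf_add]
  refine le_iInf₂ fun g hg => ?_
  rw [← normOne_congr hg]
  exact (var_le_varFun (hΦ g f hg)).trans (h g)

lemma frobeniusPerron_eq_sum (f : ℝ → ℂ) :
    frobeniusPerron a τ f = fun x => ∑ i, transferBranch τ (piece a i) f x :=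
  rfl

namespace IsPiecewiseExpanding

variable {ε σ : ℝ} {s : Fin q → ℝ} (hτ : IsPiecewiseExpanding ε a s τ)
include hτ

lemma exists_isExpandingExtension (hσ₀ : 0 < σ) (hσ : ∀ i, σ ≤ s i) (i : Fin q) :
    ∃ T, IsExpandingExtension σ (a i.castSucc) (a i.succ) τ T := by
  obtain ⟨τ₀, hτ₀, heq⟩ := hτ.extends_C1 i
  exact GenBV.exists_isExpandingExtension (hτ.strictMono i.castSucc_lt_succ) hσ₀
    hτ₀.continuousOn heq (hτ.monotonic i) fun x hx => (hσ i).trans (hτ.expanding i x hx)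

lemma exists_holder_bound : ∃ M : ℝ, 0 ≤ M ∧
    ∀ i, ∀ x ∈ piece a i, ∀ y ∈ piece a i, |deriv τ x - deriv τ y| ≤ M * |x - y| ^ ε := by
  choose M hM using hτ.holder
  refine ⟨∑ i, |M i|, by positivity, fun i x hx y hy => (hM i x hx y hy).trans ?_⟩
  gcongr
  exact (le_abs_self _).trans
    (Finset.single_le_sum (f := (|M ·|)) (fun _ _ => abs_nonneg _) (Finset.mem_univ i))

end IsPiecewiseExpanding

variable {σ : ℝ} {T : Fin q → ℝ ≃ₜ ℝ}
  (hT : ∀ i, IsExpandingExtension σ (a i.castSucc) (a i.succ) τ (T i))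
  (ha : StrictMono a) (h₀ : a 0 = 0) (h₁ : a (Fin.last q) = 1)

include hT ha h₀ h₁

lemma frobeniusPerron_congr_ae (hfg : f =ᵐ[mI] g) :
    frobeniusPerron a τ f =ᵐ[mI] frobeniusPerron a τ g := by
  have branch_congr : ∀ᵐ x ∂mI, ∀ i,
      transferBranch τ (piece a i) f x = transferBranch τ (piece a i) g x :=
    ae_all_iff.2 fun i => ae_restrict_of_ae <| (hT i).transferBranch_congr_ae <|
      ae_restrict_of_ae_restrict_of_subset (piece_subset_Icc ha.monotone h₀ h₁ i) hfg
  filter_upwards [branch_congr] with x hx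
  simp only [frobeniusPerron_eq_sum, hx]

lemma aestronglyMeasurable_frobeniusPerron (hf : AEStronglyMeasurable f mI) :
    AEStronglyMeasurable (frobeniusPerron a τ f) mI :=
  Finset.aestronglyMeasurable_fun_sum _ fun i _ =>
    ((hT i).aestronglyMeasurable_transferBranch
      (hf.mono_set (piece_subset_Icc ha.monotone h₀ h₁ i))).restrict

lemma normOne_frobeniusPerron_le (hσ : 0 < σ) (hf : AEStronglyMeasurable f mI) :
    normOne (frobeniusPerron a τ f) ≤ normOne f := by
  have aemeasurable (i : Fin q) : AEMeasurable (‖transferBranch τ (piece a i) f ·‖ₑ) :=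
    ((hT i).aestronglyMeasurable_transferBranch
      (hf.mono_set (piece_subset_Icc ha.monotone h₀ h₁ i))).enorm
  calc normOne (frobeniusPerron a τ f)
      ≤ ∫⁻ x, ∑ i, ‖transferBranch τ (piece a i) f x‖ₑ :=
        (lintegral_mono fun x => enorm_sum_le _ _).trans (setLIntegral_le_lintegral _ _)
    _ = ∑ i, ∫⁻ z in piece a i, ‖f z‖ₑ := by
        rw [lintegral_finsetSum' _ fun i _ => aemeasurable i]
        exact Finset.sum_congr rfl fun i _ => (hT i).lintegral_enorm_transferBranch hσ f
    _ ≤ normOne f := sum_setLIntegral_piece_le ha.monotone h₀ h₁ _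

lemma oscOne_frobeniusPerron_le {c r : ℝ} (hσ : 1 ≤ σ) (hr : 0 < r)
    (hc : ∀ i, ∀ x ∈ piece a i, ∀ y ∈ piece a i, |x - y| < r / σ → |deriv τ x - deriv τ y| ≤ c)
    (f : ℝ → ℂ) :
    oscOne (frobeniusPerron a τ f) r ≤
      (1 + ENNReal.ofReal (2 * c)) *
        ∑ i, (∫⁻ z, oscOn univ ((piece a i).indicator f) (r / σ) z) +
      ENNReal.ofReal (2 * c) * normOne f := by
  calc oscOne (frobeniusPerron a τ f) r
      ≤ ∫⁻ x, ∑ i, oscOn univ (transferBranch τ (piece a i) f) r x := by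
        rw [oscOne, osc_eq_oscOn]
        exact (lintegral_mono fun x => (oscOn_mono (subset_univ _) le_rfl).trans
          (oscOn_sum_le _ _)).trans (setLIntegral_le_lintegral _ _)
    _ = ∑ i, ∫⁻ x, oscOn univ (transferBranch τ (piece a i) f) r x :=
        lintegral_finsetSum _ fun _ _ => measurable_oscOn
    _ ≤ ∑ i, ((1 + ENNReal.ofReal (2 * c)) *
          (∫⁻ z, oscOn univ ((piece a i).indicator f) (r / σ) z) +
            ENNReal.ofReal (2 * c) * ∫⁻ z in piece a i, ‖f z‖ₑ) :=
        Finset.sum_le_sum fun i _ => (hT i).lintegral_oscOn_transferBranch_le f hσ hr (hc i)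
    _ ≤ _ := by
        rw [Finset.sum_add_distrib, ← Finset.mul_sum, ← Finset.mul_sum]
        gcongr
        exact sum_setLIntegral_piece_le ha.monotone h₀ h₁ _

variable {β δ K M : ℝ} (hσ : 1 ≤ σ) (hp : 0 ≤ p) (hM₀ : 0 ≤ M)
  (hM : ∀ i, ∀ x ∈ piece a i, ∀ y ∈ piece a i, |deriv τ x - deriv τ y| ≤ M * |x - y| ^ (1 / p))
  (hδ : 2 * (M * A ^ (1 / p)) ≤ δ) (hδ₀ : 0 ≤ δ) (hK : 0 ≤ K) (hβ : CutoffBound a A p σ β K)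
include hσ hp hM₀ hM hδ hδ₀ hK hβ

lemma varFun_frobeniusPerron_le (f : ℝ → ℂ) :
    varFun A p (frobeniusPerron a τ f) ≤ ENNReal.ofReal ((1 + δ) * β) * varFun A p f +
      ENNReal.ofReal ((1 + δ) * K + 2 * M) * normOne f := by
  refine varFun_le fun r hr hrA => ?_
  have modulus : ∀ i, ∀ x ∈ piece a i, ∀ y ∈ piece a i, |x - y| < r / σ →
      |deriv τ x - deriv τ y| ≤ M * r ^ (1 / p) := fun i x hx y hy hxy => by
    refine (hM i x hx y hy).trans ?_
    gcongr
    exact hxy.le.trans (div_le_self hr.le hσ)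
  have distortion : 1 + ENNReal.ofReal (2 * (M * r ^ (1 / p))) ≤ ENNReal.ofReal (1 + δ) := by
    rw [ENNReal.ofReal_add zero_le_one hδ₀, ENNReal.ofReal_one]
    gcongr
    exact le_trans (by gcongr) hδ
  calc _ ≤ (1 + ENNReal.ofReal (2 * (M * r ^ (1 / p)))) *
          ∑ i, (∫⁻ z, oscOn univ ((piece a i).indicator f) (r / σ) z) +
          ENNReal.ofReal (2 * (M * r ^ (1 / p))) * normOne f :=
        oscOne_frobeniusPerron_le hT ha h₀ h₁ hσ hr modulus f
    _ ≤ ENNReal.ofReal (1 + δ) * (ENNReal.ofReal (r ^ (1 / p)) *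
          (ENNReal.ofReal β * varFun A p f + ENNReal.ofReal K * normOne f)) +
          ENNReal.ofReal (r ^ (1 / p) * (2 * M)) * normOne f := by
        gcongr ?_ * ?_ + ENNReal.ofReal ?_ * _
        exacts [hβ f r hr hrA, (by ring : _ = _).le]
    _ = _ := by
        rw [ENNReal.ofReal_add (p := (1 + δ) * K) (by positivity) (by positivity),
          ENNReal.ofReal_mul (p := r ^ (1 / p)) (by positivity),
          ENNReal.ofReal_mul (q := β) (by positivity), ENNReal.ofReal_mul (q := K) (by positivity)]
        ring

lemma var_frobeniusPerron_le (hβ₀ : 0 < β) (f : ℝ → ℂ) :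
    var A p (frobeniusPerron a τ f) ≤ ENNReal.ofReal ((1 + δ) * β) * var A p f +
      ENNReal.ofReal ((1 + δ) * K + 2 * M) * normOne f :=
  var_map_le (ENNReal.ofReal_pos.2 (by positivity)).ne' ENNReal.ofReal_ne_top
    (fun _ _ => frobeniusPerron_congr_ae hT ha h₀ h₁)
    (varFun_frobeniusPerron_le hT ha h₀ h₁ hσ hp hM₀ hM hδ hδ₀ hK hβ) f

end Operator

section LasotaYorke

variable {A p α K : ℝ} {Φ : (ℝ → ℂ) → ℝ → ℂ} {f : ℝ → ℂ}

/-- `Φ` is an `L¹`-contraction which satisfies a Lasota-Yorke inequality, with the contraction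
factor `α < 1`, for the norm `normBV A p`. -/
structure IsLasotaYorke (A p α K : ℝ) (Φ : (ℝ → ℂ) → ℝ → ℂ) : Prop where
  pos : 0 < α
  lt_one : α < 1
  const_pos : 0 < K
  aestronglyMeasurable : ∀ {f}, AEStronglyMeasurable f mI → AEStronglyMeasurable (Φ f) mI
  normOne_le : ∀ {f}, AEStronglyMeasurable f mI → normOne (Φ f) ≤ normOne f
  normBV_le : ∀ {f}, MemBV A p f →
    normBV A p (Φ f) ≤ ENNReal.ofReal α * normBV A p f + ENNReal.ofReal K * normOne f

lemma MemBV.normBV_lt_top (hf : MemBV A p f) : normBV A p f < ⊤ :=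
  ENNReal.add_lt_top.2 ⟨hf.2, hf.1.2⟩

lemma normBV_eq_zero (hf : AEStronglyMeasurable f mI) (h : normOne f = 0) : normBV A p f = 0 := by
  have ae_zero : (fun _ => 0) =ᵐ[mI] f := by
    filter_upwards [(lintegral_eq_zero_iff' hf.enorm).1 h] with x hx
    exact (enorm_eq_zero.1 hx).symm
  have oscOne_zero (r : ℝ) : oscOne (fun _ => 0) r = 0 := by simp [oscOne, osc]
  rw [normBV, h, add_zero, ← nonpos_iff_eq_zero]
  exact (var_le_varFun ae_zero).trans (varFun_le fun r _ _ => by simp [oscOne_zero])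

lemma le_ofReal_pow_mul_add_of_succ_le (hα₀ : 0 ≤ α) (hα : α < 1) (hK : 0 ≤ K)
    {u : ℕ → ENNReal} {b : ENNReal}
    (h : ∀ n, u (n + 1) ≤ ENNReal.ofReal α * u n + ENNReal.ofReal K * b) (n : ℕ) :
    u n ≤ ENNReal.ofReal (α ^ n) * u 0 + ENNReal.ofReal (K / (1 - α)) * b := by
  have one_sub_pos : 0 < 1 - α := sub_pos.2 hα
  have fixed_point : K / (1 - α) = α * (K / (1 - α)) + K := by
    field_simp
    ring
  induction n with
  | zero => simp
  | succ n ih =>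
    calc u (n + 1) ≤ ENNReal.ofReal α *
            (ENNReal.ofReal (α ^ n) * u 0 + ENNReal.ofReal (K / (1 - α)) * b) +
            ENNReal.ofReal K * b := (h n).trans (by gcongr)
      _ = ENNReal.ofReal (α ^ (n + 1)) * u 0 + ENNReal.ofReal (α * (K / (1 - α)) + K) * b := by
          rw [ENNReal.ofReal_add (by positivity) hK, ENNReal.ofReal_mul hα₀, pow_succ',
            ENNReal.ofReal_mul hα₀]
          ring
      _ = _ := by rw [← fixed_point]

namespace IsLasotaYorke

variable (h : IsLasotaYorke A p α K Φ)
include h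

lemma div_one_sub_nonneg : 0 ≤ K / (1 - α) :=
  div_nonneg h.const_pos.le (sub_nonneg.2 h.lt_one.le)

lemma memBV (hf : MemBV A p f) : MemBV A p (Φ f) := by
  have hfm := hf.1.aestronglyMeasurable
  refine ⟨⟨h.aestronglyMeasurable hfm, (h.normOne_le hfm).trans_lt hf.1.2⟩, ?_⟩
  have normBV_lt_top := hf.normBV_lt_top
  have normOne_lt_top : normOne f < ⊤ := hf.1.2
  calc var A p (Φ f) ≤ normBV A p (Φ f) := le_self_add
    _ ≤ _ := h.normBV_le hf
    _ < ⊤ := by finiteness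

lemma memBV_iterate (hf : MemBV A p f) (n : ℕ) : MemBV A p (Φ^[n] f) :=
  Function.Iterate.rec (MemBV A p) hf (fun _ => h.memBV) n

lemma normOne_iterate_le (hf : MemBV A p f) (n : ℕ) : normOne (Φ^[n] f) ≤ normOne f := by
  induction n with
  | zero => exact le_rfl
  | succ n ih =>
    rw [Function.iterate_succ_apply']
    exact (h.normOne_le (h.memBV_iterate hf n).1.aestronglyMeasurable).trans ih

lemma normBV_iterate_le (hf : MemBV A p f) (n : ℕ) :
    normBV A p (Φ^[n] f) ≤
      ENNReal.ofReal (α ^ n) * normBV A p f + ENNReal.ofReal (K / (1 - α)) * normOne f := by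
  refine le_ofReal_pow_mul_add_of_succ_le (u := fun n => normBV A p (Φ^[n] f)) h.pos.le h.lt_one
    h.const_pos.le (fun n => ?_) n
  rw [Function.iterate_succ_apply']
  refine (h.normBV_le (h.memBV_iterate hf n)).trans ?_
  gcongr
  exact h.normOne_iterate_le hf n

lemma normBV_iterate_le_normBV (hf : MemBV A p f) (n : ℕ) :
    normBV A p (Φ^[n] f) ≤ ENNReal.ofReal (1 + K / (1 - α)) * normBV A p f := by
  rw [ENNReal.ofReal_add zero_le_one h.div_one_sub_nonneg, add_mul]
  refine (h.normBV_iterate_le hf n).trans ?_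
  gcongr
  · exact pow_le_one₀ h.pos.le h.lt_one.le
  · exact le_add_self

lemma eventually_normBV_iterate_le (hf : MemBV A p f) :
    ∀ᶠ n : ℕ in atTop,
      normBV A p (Φ^[n] f) ≤ ENNReal.ofReal (1 + K / (1 - α)) * normOne f := by
  rcases eq_or_ne (normOne f) 0 with zero | ne_zero
  · refine Eventually.of_forall fun n => (h.normBV_iterate_le_normBV hf n).trans ?_
    rw [zero, normBV_eq_zero hf.1.aestronglyMeasurable zero]
  · have transient : Tendsto (fun n : ℕ => ENNReal.ofReal (α ^ n) * normBV A p f) atTop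
        (nhds 0) := by
      simpa using ENNReal.Tendsto.mul_const (ENNReal.tendsto_ofReal
        (tendsto_pow_atTop_nhds_zero_of_lt_one h.pos.le h.lt_one)) (.inr hf.normBV_lt_top.ne)
    filter_upwards [transient.eventually_le_const (pos_iff_ne_zero.2 ne_zero)] with n hn
    rw [ENNReal.ofReal_add zero_le_one h.div_one_sub_nonneg, add_mul, ENNReal.ofReal_one, one_mul]
    exact (h.normBV_iterate_le hf n).trans (by gcongr)

end IsLasotaYorke

lemma isLasotaYorke_of_var_le (hα₀ : 0 < α) (hα : α < 1) (hK : 0 ≤ K)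
    (hm : ∀ {f}, AEStronglyMeasurable f mI → AEStronglyMeasurable (Φ f) mI)
    (hone : ∀ {f}, AEStronglyMeasurable f mI → normOne (Φ f) ≤ normOne f)
    (hvar : ∀ f, var A p (Φ f) ≤ ENNReal.ofReal α * var A p f + ENNReal.ofReal K * normOne f) :
    IsLasotaYorke A p α (K + 1) Φ where
  pos := hα₀
  lt_one := hα
  const_pos := by positivity
  aestronglyMeasurable := hm
  normOne_le := hone
  normBV_le {f} hf := by
    calc normBV A p (Φ f)
        ≤ ENNReal.ofReal α * var A p f + ENNReal.ofReal K * normOne f + normOne f :=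
          add_le_add (hvar f) (hone hf.1.aestronglyMeasurable)
      _ = ENNReal.ofReal α * var A p f + ENNReal.ofReal (K + 1) * normOne f := by
          rw [ENNReal.ofReal_add hK zero_le_one, ENNReal.ofReal_one]
          ring
      _ ≤ _ := by
          gcongr
          exact le_self_add

lemma exists_pos_forall_two_mul_mul_rpow_le {M δ : ℝ} (hp : 0 < p) (hM : 0 ≤ M) (hδ : 0 < δ) :
    ∃ A₀ : ℝ, 0 < A₀ ∧ ∀ A, 0 < A → A ≤ A₀ → 2 * (M * A ^ (1 / p)) ≤ δ := by
  refine ⟨(δ / (2 * M + 1)) ^ p, by positivity, fun A hA hAA₀ => ?_⟩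
  have root_le : A ^ (1 / p) ≤ δ / (2 * M + 1) := by
    rwa [one_div, Real.rpow_inv_le_iff_of_pos hA.le (by positivity) hp]
  rw [le_div_iff₀ (by positivity)] at root_le
  linarith [show 0 ≤ A ^ (1 / p) by positivity]

theorem IsPiecewiseExpanding.exists_isLasotaYorke_frobeniusPerron {q : ℕ} {a : Fin (q + 1) → ℝ}
    {s : Fin q → ℝ} {τ : ℝ → ℝ} {σ : ℝ} (hτ : IsPiecewiseExpanding (1 / p) a s τ) (hp : 1 ≤ p)
    (hσ₁ : 1 < σ) (hσs : ∀ i, σ ≤ s i) (hσ : 1 / σ ^ (1 / p) + 1 / σ < 1) :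
    ∃ A₀ : ℝ, 0 < A₀ ∧ ∀ A, 0 < A → A ≤ A₀ →
      ∃ α K, IsLasotaYorke A p α K (frobeniusPerron a τ) := by
  have hσ₀ : 0 < σ := one_pos.trans hσ₁
  have hp₀ : 0 < p := one_pos.trans_le hp
  choose T hT using hτ.exists_isExpandingExtension hσ₀ hσs
  obtain ⟨M, hM₀, hM⟩ := hτ.exists_holder_bound
  obtain ⟨β, A₁, hβ₀, hβ₁, hA₁, cutoff⟩ :=
    exists_cutoffBound hτ.strictMono hτ.first hτ.last hp hσ₁ hσ
  set δ := (1 - β) / (2 * β)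
  have hδ₀ : 0 < δ := div_pos (by linarith) (by positivity)
  have contraction : (1 + δ) * β = (1 + β) / 2 := by
    simp only [δ]
    field_simp
    ring
  obtain ⟨A₂, hA₂, hδ⟩ := exists_pos_forall_two_mul_mul_rpow_le hp₀ hM₀ hδ₀
  refine ⟨min A₁ A₂, lt_min hA₁ hA₂, fun A hA hAA => ?_⟩
  obtain ⟨K, hK, hβ⟩ := cutoff A hA (hAA.trans (min_le_left _ _))
  exact ⟨(1 + δ) * β, _, isLasotaYorke_of_var_le (by positivity) (by linarith) (by positivity)
    (aestronglyMeasurable_frobeniusPerron hT hτ.strictMono hτ.first hτ.last)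
    (normOne_frobeniusPerron_le hT hτ.strictMono hτ.first hτ.last hσ₀)
    (var_frobeniusPerron_le hT hτ.strictMono hτ.first hτ.last hσ₁.le hp₀.le hM₀ hM
      (hδ A hA (hAA.trans (min_le_right _ _))) hδ₀.le hK.le hβ hβ₀)⟩

lemma IsPiecewiseExpanding.one_lt_iInf {ε : ℝ} {q : ℕ} {a : Fin (q + 1) → ℝ} {s : Fin q → ℝ}
    {τ : ℝ → ℝ} (hτ : IsPiecewiseExpanding ε a s τ) : 1 < ⨅ i, s i := by
  have q_ne_zero : q ≠ 0 := by
    rintro rfl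
    exact zero_ne_one (hτ.first.symm.trans hτ.last)
  have : Nonempty (Fin q) := Fin.pos_iff_nonempty.1 (Nat.pos_of_ne_zero q_ne_zero)
  obtain ⟨i, hi⟩ := exists_eq_ciInf_of_finite (f := s)
  exact hi ▸ hτ.one_lt i

end LasotaYorke

end GenBV

end

theorem theorem3p2p3 (p : ℝ) (hp : 1 ≤ p) (q : ℕ) (a : Fin (q + 1) → ℝ) (s : Fin q → ℝ)
    (τ : ℝ → ℝ) (hτ : GenBV.IsPiecewiseExpanding (1 / p) a s τ)
    (hs : 1 / (⨅ i, s i) ^ (1 / p) + 1 / (⨅ i, s i) < 1) :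
    ∃ A₀ : ℝ, 0 < A₀ ∧ ∀ A : ℝ, 0 < A → A ≤ A₀ →
      ∃ α K : ℝ, 0 < α ∧ α < 1 ∧ 0 < K ∧
        -- `α` and `K` are constants of a Lasota-Yorke inequality
        (∀ f : ℝ → ℂ, GenBV.MemBV A p f →
          GenBV.normBV A p (GenBV.frobeniusPerron a τ f) ≤
            ENNReal.ofReal α * GenBV.normBV A p f + ENNReal.ofReal K * GenBV.normOne f) ∧
        -- the iterates are uniformly bounded on `BV_{1,1/p}`
        (∀ f : ℝ → ℂ, GenBV.MemBV A p f → ∀ n : ℕ,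
          GenBV.MemBV A p ((GenBV.frobeniusPerron a τ)^[n] f) ∧
          GenBV.normBV A p ((GenBV.frobeniusPerron a τ)^[n] f) ≤
            ENNReal.ofReal (1 + K / (1 - α)) * GenBV.normBV A p f) ∧
        -- for large `n` they are bounded by the `L¹`-norm
        (∀ f : ℝ → ℂ, GenBV.MemBV A p f → ∀ᶠ n : ℕ in Filter.atTop,
          GenBV.normBV A p ((GenBV.frobeniusPerron a τ)^[n] f) ≤
            ENNReal.ofReal (1 + K / (1 - α)) * GenBV.normOne f) := by
  have slope_le (i : Fin q) : ⨅ i, s i ≤ s i := ciInf_le (Set.finite_range s).bddBelow i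
  obtain ⟨A₀, hA₀, lasotaYorke⟩ :=
    hτ.exists_isLasotaYorke_frobeniusPerron hp hτ.one_lt_iInf slope_le hs
  refine ⟨A₀, hA₀, fun A hA hAA₀ => ?_⟩
  obtain ⟨α, K, h⟩ := lasotaYorke A hA hAA₀
  exact ⟨α, K, h.pos, h.lt_one, h.const_pos, fun f => h.normBV_le,
    fun f hf n => ⟨h.memBV_iterate hf n, h.normBV_iterate_le_normBV hf n⟩,
    fun f => h.eventually_normBV_iterate_le⟩
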